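/- For a measurable function $f:(0,\infty)\to[0,\infty]$ and $x>0$ let $H^*f(x)=\int_x^\infty f(t)\,\frac{dt}{t}$, let ${H^*}^2f=H^*(H^*f)$, and let $\|\cdot\|_p$ be the norm of $L^p(0,\infty)$, with value $\infty$ outside $L^p(0,\infty)$. For $p>0$ let $C_p=\int_0^1|1+\ln x|^p\,dx$. Let $1<p<\infty$ and let $g$ be a nonnegative, measurable function on $(0,\infty)$ such that $H^*g(x)<\infty$ for all $x>0$. If $1<p\le 2$, then $$(p-1)\,\|H^*g\|_p\le\|({H^*}^2-H^*)g\|_p\le C_p^{1/p}\,\|H^*g\|_p ,$$ and if $2\le p<\infty$, then $$C_p^{1/p}\,\|H^*g\|_p\le\|({H^*}^2-H^*)g\|_p\le (p-1)\,\|H^*g\|_p ,$$ where in both cases the first (lower) inequality is asserted when $H^*g\in L^p(0,\infty)$, and the second (upper) inequality without this restriction. In both cases both constants are optimal, even among those $g$ with $H^*g\in L^p(0,\infty)$: the constant in the lower inequality cannot be replaced by a larger one, and the constant in the upper inequality cannot be replaced by a smaller one. -/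

import Mathlib

open MeasureTheory Set
open scoped ENNReal

noncomputable section

/-- The dual Hardy operator `H^* f(x) = ∫_x^∞ f(t) dt/t` on `[0,∞]`-valued functions.
Only arguments `x > 0` are ever used, and these only see the values of `f` on `(0,∞)`. -/
def dualHardy (f : ℝ → ℝ≥0∞) (x : ℝ) : ℝ≥0∞ :=
  ∫⁻ t in Ioi x, f t / ENNReal.ofReal t

/-- The function `(H^*² - H^*) g`. It is extended real valued: where `H^* g` is finite it is a
genuine difference, with value `+∞` where `H^*² g` is infinite. -/
def dualHardySqSub (g : ℝ → ℝ≥0∞) (x : ℝ) : EReal :=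
  (dualHardy (dualHardy g) x : EReal) - (dualHardy g x : EReal)

/-- The `L^p(0,∞)` norm, with value `∞` allowed, of an extended real valued function. -/
def halfLineNorm (p : ℝ) (u : ℝ → EReal) : ℝ≥0∞ :=
  eLpNorm (fun x => (u x).abs) (ENNReal.ofReal p) (volume.restrict (Ioi (0 : ℝ)))

/-- `‖H^* g‖_p`. -/
def normDualHardy (p : ℝ) (g : ℝ → ℝ≥0∞) : ℝ≥0∞ :=
  halfLineNorm p (fun x => (dualHardy g x : EReal))

/-- `‖(H^*² - H^*) g‖_p`. -/
def normDualHardySqSub (p : ℝ) (g : ℝ → ℝ≥0∞) : ℝ≥0∞ :=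
  halfLineNorm p (dualHardySqSub g)

/-- `g` is a nonnegative (Lebesgue) measurable function on `(0,∞)` with `H^* g(x) < ∞` for
all `x > 0`. -/
def IsAdmissible (g : ℝ → ℝ≥0∞) : Prop :=
  AEMeasurable g (volume.restrict (Ioi (0 : ℝ))) ∧ ∀ x : ℝ, 0 < x → dualHardy g x < ∞

/-- `C_p = ∫_0^1 |1 + ln x|^p dx`. -/
def hardyConst (p : ℝ) : ℝ≥0∞ :=
  ∫⁻ x in Ioo (0 : ℝ) 1, ENNReal.ofReal (|1 + Real.log x| ^ p)

end

/-! Put `f = H^* g`, a continuous decreasing function, and `F = H^* f`, so that `F' = -f / x`, and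
compare `∫ |F - f|^p` with `∫ f^p` over `(0,∞)`. If `f` is not in `L^p`, the upper bounds are
trivial; if it is, then `x f^p` and `x F^p` vanish at both ends, so that total derivatives of the
form `(x B(F, f))'` integrate to zero.

*The constant `p - 1`.* Burkholder's pointwise inequality (`burkholder_le`, `le_burkholder`)
compares `|F - f|^p - (p - 1)^p f^p` with a multiple of `F^p - p f F^(p-1) = (x F^p)'`, from above
for `p ≥ 2` and from below for `p ≤ 2`. Integration gives the bound.

*The constant `C_p^(1/p)`.* Let `X = S - 1` with `S` exponentially distributed, so that
`C_p = E |X|^p`, and let `U(F, f) = E |F + f X|^p` (`expMoment`) and `B = U - C_p f^p`. Integration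
by parts in the exponential law gives `U - f ∂U/∂F = |F - f|^p`. Hence, wherever `f` is locally
constant, the energy `x B(F, f)` has derivative `|F - f|^p - C_p f^p`. Moreover `B` is increasing in
`f` for `p ≥ 2` and decreasing for `p ≤ 2` (`monotoneOn_sign_mul_expMoment_sub`), so a decrease of
`f` moves the energy in a known direction. As `f` need not be differentiable, this is expressed by a
one-sided bound on the upper right Dini derivative, in which the second argument of `B` is frozen
(`IsHardyPair.eventually_slope_energy_lt`). Integrating that bound over `(0,∞)`, where the boundary
terms vanish, gives the comparison. Both signs are treated at once by a factor `σ` with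
`σ (p - 2) ≥ 0`.

*Sharpness.* The constant `p - 1` is approached as `f` approaches `x^(-1/p)`, an eigenfunction
of `H^*` with eigenvalue `p`; here `f = x^(-α) - 1` on `(0,1]` with `α` increasing to `1 / p`. The
constant `C_p^(1/p)` is approached as `f` tends to the indicator function of `(0,1]`, for which
`F - f = -log x - 1` there. -/

/-! ### Burkholder's pointwise inequality -/

/-- The factor `p (1 - 1/p)^(p-1)` of Burkholder's pointwise inequality. -/
noncomputable def burkholderConst (p : ℝ) : ℝ := p * (1 - 1 / p) ^ (p - 1)

theorem burkholderConst_ge_one {p : ℝ} (hp : 2 ≤ p) : 1 ≤ burkholderConst p := by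
  have hp0 : 0 < p := by linarith
  have h1 : 1 / p ≤ 1 := by rw [div_le_one hp0]; linarith
  have h := one_add_mul_self_le_rpow_one_add (s := -(1 / p)) (p := p - 1)
    (by linarith) (by linarith)
  have h2 : 1 + (p - 1) * -(1 / p) = 1 / p := by field_simp; ring
  rw [h2] at h
  unfold burkholderConst
  calc (1 : ℝ) = p * (1 / p) := by field_simp
    _ ≤ p * (1 + -(1 / p)) ^ (p - 1) := by gcongr
    _ = _ := by ring_nf

theorem burkholderConst_le_one {p : ℝ} (hp : 1 < p) (hp2 : p ≤ 2) : burkholderConst p ≤ 1 := by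
  have hp0 : 0 < p := by linarith
  have h1 : 1 / p ≤ 1 := by rw [div_le_one hp0]; linarith
  have h := rpow_one_add_le_one_add_mul_self (s := -(1 / p)) (p := p - 1)
    (by linarith) (by linarith) (by linarith)
  have h2 : 1 + (p - 1) * -(1 / p) = 1 / p := by field_simp; ring
  rw [h2] at h
  unfold burkholderConst
  calc p * (1 - 1 / p) ^ (p - 1) = p * (1 + -(1 / p)) ^ (p - 1) := by ring_nf
    _ ≤ p * (1 / p) := by gcongr
    _ = 1 := by field_simp

theorem burkholderConst_eq {p : ℝ} (hp : 1 < p) :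
    burkholderConst p = p ^ (2 - p) * (p - 1) ^ (p - 1) := by
  have hp0 : 0 < p := by linarith
  have h1 : 1 - 1 / p = (p - 1) / p := by field_simp
  rw [burkholderConst, h1, Real.div_rpow (by linarith) hp0.le,
    show (2 : ℝ) - p = 1 - (p - 1) by ring, Real.rpow_sub hp0 1, Real.rpow_one]
  ring

theorem burkholderConst_mul_sub_one {p : ℝ} (hp : 1 < p) :
    burkholderConst p * (p - 1) = p ^ (2 - p) * (p - 1) ^ p := by
  have h : (p - 1) ^ p = (p - 1) ^ (p - 1) * (p - 1) := by
    have : p - 1 ≠ 0 := by linarith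
    rw [Real.rpow_sub_one this, div_mul_cancel₀ _ this]
  rw [burkholderConst_eq hp, h]; ring

/-- The convex function `(1 - t)^(p-1)` lies below its chord over `[0, 1/p]`, which in turn lies
below the stated line, because `burkholderConst p ≥ 1`. -/
theorem chord_le_of_two_le {p t : ℝ} (hp : 2 ≤ p) (ht0 : 0 ≤ t) (ht : t ≤ 1 / p) :
    (1 - t) ^ (p - 1) ≤ burkholderConst p * (1 - (p - 1) * t) := by
  have hp0 : 0 < p := by linarith
  have h1 : 1 / p ≤ 1 := by rw [div_le_one hp0]; linarith
  have hpt : p * t ≤ 1 := by rwa [le_div_iff₀' hp0] at ht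
  have hc := (convexOn_rpow (p := p - 1) (by linarith)).2
    (show (1 : ℝ) ∈ Ici 0 by simp) (show 1 - 1 / p ∈ Ici (0 : ℝ) from sub_nonneg.2 h1)
    (show 0 ≤ 1 - p * t by linarith) (show 0 ≤ p * t by positivity) (by ring)
  simp only [smul_eq_mul, Real.one_rpow] at hc
  have e1 : (1 - p * t) * 1 + p * t * (1 - 1 / p) = 1 - t := by field_simp; ring
  rw [e1] at hc
  have h3 := burkholderConst_ge_one hp
  have e2 : p * t * (1 - 1 / p) ^ (p - 1) = burkholderConst p * t := by
    rw [burkholderConst]; ring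
  rw [e2] at hc
  nlinarith

/-- Beyond `1/p` a convex function lies above the extension of its chord over `[0, 1/p]`. -/
theorem le_chord_of_two_le {p t : ℝ} (hp : 2 ≤ p) (ht : 1 / p ≤ t) (ht1 : t ≤ 1) :
    burkholderConst p * (1 - (p - 1) * t) ≤ (1 - t) ^ (p - 1) := by
  have hp0 : 0 < p := by linarith
  have hpt : 1 ≤ p * t := by rwa [div_le_iff₀' hp0] at ht
  have ht0 : 0 < t := lt_of_lt_of_le (by positivity) ht
  have hc := (convexOn_rpow (p := p - 1) (by linarith)).2
    (show (1 : ℝ) ∈ Ici 0 by simp) (show 1 - t ∈ Ici (0 : ℝ) from sub_nonneg.2 ht1)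
    (show 0 ≤ 1 - 1 / (p * t) by rw [sub_nonneg, div_le_one (by positivity)]; exact hpt)
    (show 0 ≤ 1 / (p * t) by positivity) (by ring)
  simp only [smul_eq_mul, Real.one_rpow] at hc
  have e1 : (1 - 1 / (p * t)) * 1 + 1 / (p * t) * (1 - t) = 1 - 1 / p := by field_simp; ring
  rw [e1] at hc
  have h3 := burkholderConst_ge_one hp
  have e2 : p * t * (1 - 1 / p) ^ (p - 1) = burkholderConst p * t := by
    rw [burkholderConst]; ring
  have h4 := mul_le_mul_of_nonneg_left hc (show 0 ≤ p * t by positivity)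
  have e3 : p * t * ((1 - 1 / (p * t)) * 1 + 1 / (p * t) * (1 - t) ^ (p - 1))
    = p * t - 1 + (1 - t) ^ (p - 1) := by field_simp
  rw [e2, e3] at h4
  nlinarith

theorem le_chord_of_le_two {p t : ℝ} (hp : 1 < p) (hp2 : p ≤ 2) (ht0 : 0 ≤ t) (ht : t ≤ 1 / p) :
    burkholderConst p * (1 - (p - 1) * t) ≤ (1 - t) ^ (p - 1) := by
  have hp0 : 0 < p := by linarith
  have h1 : 1 / p ≤ 1 := by rw [div_le_one hp0]; linarith
  have hpt : p * t ≤ 1 := by rwa [le_div_iff₀' hp0] at ht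
  have hc := (Real.concaveOn_rpow (p := p - 1) (by linarith) (by linarith)).2
    (show (1 : ℝ) ∈ Ici 0 by simp) (show 1 - 1 / p ∈ Ici (0 : ℝ) from sub_nonneg.2 h1)
    (show 0 ≤ 1 - p * t by linarith) (show 0 ≤ p * t by positivity) (by ring)
  simp only [smul_eq_mul, Real.one_rpow] at hc
  have e1 : (1 - p * t) * 1 + p * t * (1 - 1 / p) = 1 - t := by field_simp; ring
  rw [e1] at hc
  have h3 := burkholderConst_le_one hp hp2
  have e2 : p * t * (1 - 1 / p) ^ (p - 1) = burkholderConst p * t := by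
    rw [burkholderConst]; ring
  rw [e2] at hc
  nlinarith

theorem chord_le_of_le_two {p t : ℝ} (hp : 1 < p) (hp2 : p ≤ 2) (ht : 1 / p ≤ t) (ht1 : t ≤ 1) :
    (1 - t) ^ (p - 1) ≤ burkholderConst p * (1 - (p - 1) * t) := by
  have hp0 : 0 < p := by linarith
  have hpt : 1 ≤ p * t := by rwa [div_le_iff₀' hp0] at ht
  have ht0 : 0 < t := lt_of_lt_of_le (by positivity) ht
  have hc := (Real.concaveOn_rpow (p := p - 1) (by linarith) (by linarith)).2
    (show (1 : ℝ) ∈ Ici 0 by simp) (show 1 - t ∈ Ici (0 : ℝ) from sub_nonneg.2 ht1)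
    (show 0 ≤ 1 - 1 / (p * t) by rw [sub_nonneg, div_le_one (by positivity)]; exact hpt)
    (show 0 ≤ 1 / (p * t) by positivity) (by ring)
  simp only [smul_eq_mul, Real.one_rpow] at hc
  have e1 : (1 - 1 / (p * t)) * 1 + 1 / (p * t) * (1 - t) = 1 - 1 / p := by field_simp; ring
  rw [e1] at hc
  have h3 := burkholderConst_le_one hp hp2
  have e2 : p * t * (1 - 1 / p) ^ (p - 1) = burkholderConst p * t := by
    rw [burkholderConst]; ring
  have h4 := mul_le_mul_of_nonneg_left hc (show 0 ≤ p * t by positivity)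
  have e3 : p * t * ((1 - 1 / (p * t)) * 1 + 1 / (p * t) * (1 - t) ^ (p - 1))
    = p * t - 1 + (1 - t) ^ (p - 1) := by field_simp
  rw [e2, e3] at h4
  nlinarith

/-- The defect of Burkholder's inequality with `f = 1` and `F = r ≥ 1`. -/
noncomputable def burkholderDefect (p r : ℝ) : ℝ :=
  (r - 1) ^ p - (p - 1) ^ p - burkholderConst p * (r ^ p - p * r ^ (p - 1))

theorem hasDerivAt_burkholderDefect {p r : ℝ} (hp : 1 < p) (hr : 1 < r) :
    HasDerivAt (burkholderDefect p)
      (p * r ^ (p - 1) *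
        ((1 - 1 / r) ^ (p - 1) - burkholderConst p * (1 - (p - 1) * (1 / r)))) r := by
  have hr0 : 0 < r := by linarith
  have h1 : HasDerivAt (fun r : ℝ => (r - 1) ^ p) (1 * p * (r - 1) ^ (p - 1)) r :=
    ((hasDerivAt_id r).sub_const 1).rpow_const (Or.inr hp.le)
  have h2 : HasDerivAt (fun r : ℝ => r ^ p) (1 * p * r ^ (p - 1)) r :=
    (hasDerivAt_id r).rpow_const (Or.inr hp.le)
  have h3 : HasDerivAt (fun r : ℝ => r ^ (p - 1)) (1 * (p - 1) * r ^ (p - 1 - 1)) r :=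
    (hasDerivAt_id r).rpow_const (Or.inl hr0.ne')
  have h := (h1.sub_const ((p - 1) ^ p)).sub ((h2.sub (h3.const_mul p)).const_mul
    (burkholderConst p))
  have e1 : r ^ (p - 1 - 1) = r ^ (p - 1) * (1 / r) := by
    rw [Real.rpow_sub_one hr0.ne']; ring
  have e2 : (r - 1) ^ (p - 1) = r ^ (p - 1) * (1 - 1 / r) ^ (p - 1) := by
    have h1r : 1 / r ≤ 1 := by rw [div_le_one hr0]; exact hr.le
    rw [← Real.mul_rpow hr0.le (by linarith)]
    congr 1; field_simp
  rw [e1, e2] at h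
  refine h.congr_deriv ?_
  ring

theorem burkholderDefect_self {p : ℝ} (hp : 1 < p) : burkholderDefect p p = 0 := by
  have hp0 : 0 < p := by linarith
  have : p ^ p = p * p ^ (p - 1) := by
    rw [Real.rpow_sub_one hp0.ne']; field_simp
  simp [burkholderDefect, this]

theorem continuous_burkholderDefect {p : ℝ} (hp : 1 < p) :
    Continuous (burkholderDefect p) := by
  unfold burkholderDefect
  have h1 : Continuous fun r : ℝ => (r - 1) ^ p :=
    (continuous_id.sub continuous_const).rpow_const fun _ => Or.inr (by linarith)
  have h2 : Continuous fun r : ℝ => r ^ p := continuous_id.rpow_const fun _ => Or.inr (by linarith)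
  have h3 : Continuous fun r : ℝ => r ^ (p - 1) :=
    continuous_id.rpow_const fun _ => Or.inr (by linarith)
  fun_prop

/-- The defect increases up to `r = p`, where it vanishes, and decreases afterwards: the sign of its
derivative is that of the difference between `(1 - t)^(p-1)` and a line, at `t = 1 / r`. -/
theorem burkholderDefect_nonpos {p r : ℝ} (hp : 2 ≤ p) (hr : 1 ≤ r) :
    burkholderDefect p r ≤ 0 := by
  have hp1 : 1 < p := by linarith
  have hp0 : 0 < p := by linarith
  rw [← burkholderDefect_self hp1]
  rcases le_total r p with h | h
  · refine monotoneOn_of_deriv_nonneg (convex_Icc 1 p) (continuous_burkholderDefect hp1).continuousOn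
      (fun x hx => ?_) (fun x hx => ?_) ⟨hr, h⟩ ⟨hp1.le, le_rfl⟩ h <;>
    rw [interior_Icc] at hx
    · exact (hasDerivAt_burkholderDefect hp1 hx.1).differentiableAt.differentiableWithinAt
    · have hx0 : 0 < x := by linarith [hx.1]
      rw [(hasDerivAt_burkholderDefect hp1 hx.1).deriv]
      have := le_chord_of_two_le hp (t := 1 / x) (one_div_le_one_div_of_le hx0 hx.2.le)
        (by rw [div_le_one hx0]; exact hx.1.le)
      exact mul_nonneg (by positivity) (by linarith)
  · refine antitoneOn_of_deriv_nonpos (convex_Ici p) (continuous_burkholderDefect hp1).continuousOn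
      (fun x hx => ?_) (fun x hx => ?_) (mem_Ici.2 le_rfl) h h <;>
    rw [interior_Ici, mem_Ioi] at hx
    · exact (hasDerivAt_burkholderDefect hp1 (by linarith)).differentiableAt.differentiableWithinAt
    · have hx0 : 0 < x := by linarith
      rw [(hasDerivAt_burkholderDefect hp1 (by linarith)).deriv]
      have := chord_le_of_two_le hp (t := 1 / x) (by positivity)
        (one_div_le_one_div_of_le hp0 hx.le)
      exact mul_nonpos_of_nonneg_of_nonpos (by positivity) (by linarith)

theorem burkholderDefect_nonneg {p r : ℝ} (hp1 : 1 < p) (hp : p ≤ 2) (hr : 1 ≤ r) :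
    0 ≤ burkholderDefect p r := by
  have hp0 : 0 < p := by linarith
  rw [← burkholderDefect_self hp1]
  rcases le_total r p with h | h
  · refine antitoneOn_of_deriv_nonpos (convex_Icc 1 p) (continuous_burkholderDefect hp1).continuousOn
      (fun x hx => ?_) (fun x hx => ?_) ⟨hr, h⟩ ⟨hp1.le, le_rfl⟩ h <;>
    rw [interior_Icc] at hx
    · exact (hasDerivAt_burkholderDefect hp1 hx.1).differentiableAt.differentiableWithinAt
    · have hx0 : 0 < x := by linarith [hx.1]
      rw [(hasDerivAt_burkholderDefect hp1 hx.1).deriv]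
      have := chord_le_of_le_two hp1 hp (t := 1 / x) (one_div_le_one_div_of_le hx0 hx.2.le)
        (by rw [div_le_one hx0]; exact hx.1.le)
      exact mul_nonpos_of_nonneg_of_nonpos (by positivity) (by linarith)
  · refine monotoneOn_of_deriv_nonneg (convex_Ici p) (continuous_burkholderDefect hp1).continuousOn
      (fun x hx => ?_) (fun x hx => ?_) (mem_Ici.2 le_rfl) h h <;>
    rw [interior_Ici, mem_Ioi] at hx
    · exact (hasDerivAt_burkholderDefect hp1 (by linarith)).differentiableAt.differentiableWithinAt
    · have hx0 : 0 < x := by linarith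
      rw [(hasDerivAt_burkholderDefect hp1 (by linarith)).deriv]
      have := le_chord_of_le_two hp1 hp (t := 1 / x) (by positivity)
        (one_div_le_one_div_of_le hp0 hx.le)
      exact mul_nonneg (by positivity) (by linarith)

/-- The defect of Burkholder's inequality with `F = 1` and `f = t ≥ 1`. -/
noncomputable def burkholderCodefect (p t : ℝ) : ℝ :=
  (t - 1) ^ p - (p - 1) ^ p * t ^ p - burkholderConst p * (1 - p * t)

theorem hasDerivAt_burkholderCodefect {p : ℝ} (hp : 1 < p) (t : ℝ) :
    HasDerivAt (burkholderCodefect p)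
      (p * ((t - 1) ^ (p - 1) - (p - 1) ^ p * t ^ (p - 1) + burkholderConst p)) t := by
  have h1 : HasDerivAt (fun r : ℝ => (r - 1) ^ p) (1 * p * (t - 1) ^ (p - 1)) t :=
    ((hasDerivAt_id t).sub_const 1).rpow_const (Or.inr hp.le)
  have h2 : HasDerivAt (fun r : ℝ => r ^ p) (1 * p * t ^ (p - 1)) t :=
    (hasDerivAt_id t).rpow_const (Or.inr hp.le)
  have h := (h1.sub (h2.const_mul ((p - 1) ^ p))).sub
    ((((hasDerivAt_id t).const_mul p).const_sub 1).const_mul (burkholderConst p))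
  refine h.congr_deriv ?_
  ring

theorem burkholderCodefect_one {p : ℝ} (hp : 1 < p) :
    burkholderCodefect p 1 = (p ^ (2 - p) - 1) * (p - 1) ^ p := by
  have h := burkholderConst_mul_sub_one hp
  simp only [burkholderCodefect, sub_self, Real.zero_rpow (by linarith : p ≠ 0), Real.one_rpow]
  linarith

/-- The defect is decreasing on `[1,∞)` because `t^(p-1)` is superadditive. -/
theorem burkholderCodefect_nonpos {p t : ℝ} (hp : 2 ≤ p) (ht : 1 ≤ t) :
    burkholderCodefect p t ≤ 0 := by
  have hp1 : 1 < p := by linarith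
  have hpp : p ^ (2 - p) ≤ 1 := Real.rpow_le_one_of_one_le_of_nonpos (by linarith) (by linarith)
  have h1 : burkholderCodefect p 1 ≤ 0 := by
    rw [burkholderCodefect_one hp1]
    exact mul_nonpos_of_nonpos_of_nonneg (by linarith) (Real.rpow_nonneg (by linarith) _)
  refine le_trans ?_ h1
  refine antitoneOn_of_deriv_nonpos (convex_Ici 1)
    (fun x _ => (hasDerivAt_burkholderCodefect hp1 x).continuousAt.continuousWithinAt)
    (fun x _ => (hasDerivAt_burkholderCodefect hp1 x).differentiableAt.differentiableWithinAt)
    (fun x hx => ?_) (mem_Ici.2 le_rfl) ht ht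
  rw [interior_Ici, mem_Ioi] at hx
  rw [(hasDerivAt_burkholderCodefect hp1 x).deriv]
  have hsup := Real.add_rpow_le_rpow_add (a := x - 1) (b := 1) (p := p - 1) (by linarith)
    zero_le_one (by linarith)
  rw [sub_add_cancel, Real.one_rpow] at hsup
  have hk : 1 ≤ (p - 1) ^ p := Real.one_le_rpow (by linarith) (by linarith)
  have hc : burkholderConst p ≤ (p - 1) ^ p := by
    rw [burkholderConst_eq hp1]
    calc p ^ (2 - p) * (p - 1) ^ (p - 1) ≤ 1 * (p - 1) ^ (p - 1) := by
          gcongr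
      _ ≤ (p - 1) ^ p := by
          rw [one_mul]; exact Real.rpow_le_rpow_of_exponent_le (by linarith) (by linarith)
  have hx1 : 0 ≤ (x - 1) ^ (p - 1) := Real.rpow_nonneg (by linarith) _
  refine mul_nonpos_of_nonneg_of_nonpos (by linarith) ?_
  nlinarith

/-- The defect is increasing on `[1,∞)` because `t^(p-1)` is subadditive. -/
theorem burkholderCodefect_nonneg {p t : ℝ} (hp1 : 1 < p) (hp : p ≤ 2) (ht : 1 ≤ t) :
    0 ≤ burkholderCodefect p t := by
  have hpp : 1 ≤ p ^ (2 - p) := Real.one_le_rpow (by linarith) (by linarith)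
  have h1 : 0 ≤ burkholderCodefect p 1 := by
    rw [burkholderCodefect_one hp1]
    exact mul_nonneg (by linarith) (Real.rpow_nonneg (by linarith) _)
  refine h1.trans ?_
  refine monotoneOn_of_deriv_nonneg (convex_Ici 1)
    (fun x _ => (hasDerivAt_burkholderCodefect hp1 x).continuousAt.continuousWithinAt)
    (fun x _ => (hasDerivAt_burkholderCodefect hp1 x).differentiableAt.differentiableWithinAt)
    (fun x hx => ?_) (mem_Ici.2 le_rfl) ht ht
  rw [interior_Ici, mem_Ioi] at hx
  rw [(hasDerivAt_burkholderCodefect hp1 x).deriv]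
  have hsub := Real.rpow_add_le_add_rpow (a := x - 1) (b := 1) (p := p - 1) (by linarith)
    zero_le_one (by linarith) (by linarith)
  rw [sub_add_cancel, Real.one_rpow] at hsub
  have hk : (p - 1) ^ p ≤ 1 := Real.rpow_le_one (by linarith) (by linarith) (by linarith)
  have hk0 : 0 ≤ (p - 1) ^ p := Real.rpow_nonneg (by linarith) _
  have hc : (p - 1) ^ p ≤ burkholderConst p := by
    rw [burkholderConst_eq hp1]
    calc (p - 1) ^ p ≤ (p - 1) ^ (p - 1) :=
          Real.rpow_le_rpow_of_exponent_ge (by linarith) (by linarith) (by linarith)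
      _ = 1 * (p - 1) ^ (p - 1) := (one_mul _).symm
      _ ≤ p ^ (2 - p) * (p - 1) ^ (p - 1) := by
          gcongr
  have hx1 : 0 ≤ (x - 1) ^ (p - 1) := Real.rpow_nonneg (by linarith) _
  refine mul_nonneg (by linarith) ?_
  nlinarith

theorem burkholder_eq_of_le {p f F : ℝ} (hf : 0 < f) (hfF : f ≤ F) :
    |F - f| ^ p - (p - 1) ^ p * f ^ p - burkholderConst p * (F ^ p - p * f * F ^ (p - 1))
      = f ^ p * burkholderDefect p (F / f) := by
  obtain ⟨r, rfl⟩ : ∃ r, F = f * r := ⟨F / f, by field_simp⟩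
  have hr : 1 ≤ r := by nlinarith
  have e : |f * r - f| = f * (r - 1) := by rw [abs_of_nonneg (by linarith)]; ring
  have e2 : f ^ p = f * f ^ (p - 1) := by rw [Real.rpow_sub_one hf.ne']; field_simp
  rw [e, Real.mul_rpow hf.le (by linarith), Real.mul_rpow hf.le (by linarith),
    Real.mul_rpow hf.le (by linarith), mul_div_cancel_left₀ _ hf.ne', burkholderDefect, e2]
  ring

theorem burkholder_eq_of_ge {p f F : ℝ} (hF : 0 < F) (hfF : F ≤ f) :
    |F - f| ^ p - (p - 1) ^ p * f ^ p - burkholderConst p * (F ^ p - p * f * F ^ (p - 1))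
      = F ^ p * burkholderCodefect p (f / F) := by
  obtain ⟨r, rfl⟩ : ∃ r, f = F * r := ⟨f / F, by field_simp⟩
  have hr : 1 ≤ r := by nlinarith
  have e : |F - F * r| = F * (r - 1) := by rw [abs_of_nonpos (by linarith)]; ring
  have e2 : F ^ p = F * F ^ (p - 1) := by rw [Real.rpow_sub_one hF.ne']; field_simp
  rw [e, Real.mul_rpow hF.le (by linarith), Real.mul_rpow hF.le (by linarith),
    mul_div_cancel_left₀ _ hF.ne', burkholderCodefect, e2]
  ring

/-- Burkholder's inequality, in the variables `f = |x|` and `F = |x| + |y|`. -/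
theorem burkholder_le {p f F : ℝ} (hp : 2 ≤ p) (hf : 0 ≤ f) (hF : 0 ≤ F) :
    |F - f| ^ p ≤
      (p - 1) ^ p * f ^ p + burkholderConst p * (F ^ p - p * f * F ^ (p - 1)) := by
  have hp1 : 1 < p := by linarith
  suffices |F - f| ^ p - (p - 1) ^ p * f ^ p
      - burkholderConst p * (F ^ p - p * f * F ^ (p - 1)) ≤ 0 by linarith
  rcases hf.eq_or_lt with rfl | hf0
  · have := burkholderConst_ge_one hp
    have h2 := Real.rpow_nonneg hF p
    simp only [sub_zero, abs_of_nonneg hF, Real.zero_rpow (by linarith : p ≠ 0)]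
    nlinarith
  rcases hF.eq_or_lt with rfl | hF0
  · have : 1 ≤ (p - 1) ^ p := Real.one_le_rpow (by linarith) (by linarith)
    have h2 := Real.rpow_nonneg hf p
    simp only [zero_sub, abs_neg, abs_of_nonneg hf, Real.zero_rpow (by linarith : p ≠ 0),
      Real.zero_rpow (by linarith : p - 1 ≠ 0)]
    nlinarith
  rcases le_total f F with h | h
  · rw [burkholder_eq_of_le hf0 h]
    exact mul_nonpos_of_nonneg_of_nonpos (by positivity)
      (burkholderDefect_nonpos hp (by rwa [one_le_div hf0]))
  · rw [burkholder_eq_of_ge hF0 h]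
    exact mul_nonpos_of_nonneg_of_nonpos (by positivity)
      (burkholderCodefect_nonpos hp (by rwa [one_le_div hF0]))

/-- The reverse of `burkholder_le`, for `1 < p ≤ 2`. -/
theorem le_burkholder {p f F : ℝ} (hp1 : 1 < p) (hp : p ≤ 2) (hf : 0 ≤ f) (hF : 0 ≤ F) :
    (p - 1) ^ p * f ^ p + burkholderConst p * (F ^ p - p * f * F ^ (p - 1)) ≤ |F - f| ^ p := by
  suffices 0 ≤ |F - f| ^ p - (p - 1) ^ p * f ^ p
      - burkholderConst p * (F ^ p - p * f * F ^ (p - 1)) by linarith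
  rcases hf.eq_or_lt with rfl | hf0
  · have := burkholderConst_le_one hp1 hp
    have h2 := Real.rpow_nonneg hF p
    simp only [sub_zero, abs_of_nonneg hF, Real.zero_rpow (by linarith : p ≠ 0)]
    nlinarith
  rcases hF.eq_or_lt with rfl | hF0
  · have : (p - 1) ^ p ≤ 1 := Real.rpow_le_one (by linarith) (by linarith) (by linarith)
    have h2 := Real.rpow_nonneg hf p
    simp only [zero_sub, abs_neg, abs_of_nonneg hf, Real.zero_rpow (by linarith : p ≠ 0),
      Real.zero_rpow (by linarith : p - 1 ≠ 0)]
    nlinarith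
  rcases le_total f F with h | h
  · rw [burkholder_eq_of_le hf0 h]
    exact mul_nonneg (by positivity)
      (burkholderDefect_nonneg hp1 hp (by rwa [one_le_div hf0]))
  · rw [burkholder_eq_of_ge hF0 h]
    exact mul_nonneg (by positivity)
      (burkholderCodefect_nonneg hp1 hp (by rwa [one_le_div hF0]))

/-! ### Moments of the centred exponential law -/

/-- The differences `(F + a)^q - a^q` increase in `a` for `q ≥ 1` and decrease for `q ≤ 1`; the
factor `σ`, of the sign of `q - 1`, treats both cases at once. -/
theorem sign_mul_rpow_second_difference_nonneg {σ q F a b : ℝ} (hq : 0 < q)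
    (hσ : 0 ≤ σ * (q - 1)) (hF : 0 ≤ F) (ha : 0 ≤ a) (hab : a ≤ b) :
    0 ≤ σ * ((F + b) ^ q - b ^ q - (F + a) ^ q + a ^ q) := by
  have hd : ∀ z : ℝ, 0 < z → HasDerivAt (fun z : ℝ => σ * ((F + z) ^ q - z ^ q))
      (q * (σ * ((F + z) ^ (q - 1) - z ^ (q - 1)))) z := fun z hz => by
    have h1 : HasDerivAt (fun z : ℝ => (F + z) ^ q) (1 * q * (F + z) ^ (q - 1)) z :=
      ((hasDerivAt_id z).const_add F).rpow_const (Or.inl (by simp only [id]; linarith))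
    have h2 : HasDerivAt (fun z : ℝ => z ^ q) (1 * q * z ^ (q - 1)) z :=
      (hasDerivAt_id z).rpow_const (Or.inl hz.ne')
    exact ((h1.sub h2).const_mul σ).congr_deriv (by ring)
  have hc : Continuous fun z : ℝ => σ * ((F + z) ^ q - z ^ q) := by
    have h1 : Continuous fun z : ℝ => (F + z) ^ q :=
      (continuous_const.add continuous_id).rpow_const fun _ => Or.inr hq.le
    have h2 : Continuous fun z : ℝ => z ^ q := continuous_id.rpow_const fun _ => Or.inr hq.le
    fun_prop
  have hm : MonotoneOn (fun z : ℝ => σ * ((F + z) ^ q - z ^ q)) (Ici 0) := by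
    refine monotoneOn_of_deriv_nonneg (convex_Ici 0) hc.continuousOn ?_ ?_ <;>
    intro z hz <;> rw [interior_Ici, mem_Ioi] at hz
    · exact (hd z hz).differentiableAt.differentiableWithinAt
    · rw [(hd z hz).deriv]
      refine mul_nonneg hq.le ?_
      rcases lt_trichotomy q 1 with h | rfl | h
      · have : σ ≤ 0 := by nlinarith
        exact mul_nonneg_of_nonpos_of_nonpos this
          (sub_nonpos.2 (Real.rpow_le_rpow_of_nonpos hz (by linarith) (by linarith)))
      · simp
      · have : 0 ≤ σ := by nlinarith
        exact mul_nonneg this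
          (sub_nonneg.2 (Real.rpow_le_rpow hz.le (by linarith) (by linarith)))
  have := hm (mem_Ici.2 ha) (mem_Ici.2 (ha.trans hab)) hab
  simp only at this
  linarith

/-- Up to the sign of `p - 2`, the even part of `X ↦ |F + f X|^p - |f X|^p` increases with `f`. -/
theorem monotoneOn_sign_mul_abs_rpow_symm {σ p F : ℝ} (hp : 1 < p) (hσ : 0 ≤ σ * (p - 2))
    (hF : 0 ≤ F) :
    MonotoneOn (fun z : ℝ => σ * (|F + z| ^ p + |F - z| ^ p - 2 * z ^ p)) (Ici 0) := by
  have hq : 0 < p - 1 := by linarith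
  have hσ' : 0 ≤ σ * (p - 1 - 1) := by convert hσ using 2; ring
  have key : ∀ z : ℝ, HasDerivAt (fun z : ℝ => σ * (|F + z| ^ p + |F - z| ^ p - 2 * z ^ p))
      (p * (σ * (|F + z| ^ (p - 2) * (F + z) - |F - z| ^ (p - 2) * (F - z)
        - 2 * z ^ (p - 1)))) z := fun z => by
    have h1 : HasDerivAt (fun z : ℝ => |F + z| ^ p) (p * |F + z| ^ (p - 2) * (F + z) * 1) z :=
      (hasDerivAt_abs_rpow (F + z) hp).comp z ((hasDerivAt_id z).const_add F)
    have h2 : HasDerivAt (fun z : ℝ => |F - z| ^ p) (p * |F - z| ^ (p - 2) * (F - z) * (-1)) z :=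
      (hasDerivAt_abs_rpow (F - z) hp).comp z ((hasDerivAt_id z).const_sub F)
    have h3 : HasDerivAt (fun z : ℝ => z ^ p) (1 * p * z ^ (p - 1)) z :=
      (hasDerivAt_id z).rpow_const (Or.inr hp.le)
    exact (((h1.add h2).sub (h3.const_mul 2)).const_mul σ).congr_deriv (by ring)
  have hpow : ∀ w : ℝ, 0 ≤ w → |w| ^ (p - 2) * w = w ^ (p - 1) := fun w hw => by
    rcases hw.eq_or_lt with rfl | h
    · simp [Real.zero_rpow hq.ne']
    · rw [abs_of_pos h, ← Real.rpow_add_one h.ne']; ring_nf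
  refine monotoneOn_of_deriv_nonneg (convex_Ici 0)
    (fun z _ => (key z).continuousAt.continuousWithinAt)
    (fun z _ => (key z).differentiableAt.differentiableWithinAt) fun z hz => ?_
  rw [interior_Ici, mem_Ioi] at hz
  rw [(key z).deriv]
  refine mul_nonneg (by linarith) ?_
  rw [hpow (F + z) (by linarith)]
  rcases le_total z F with h | h
  · rw [hpow (F - z) (by linarith)]
    have h1 := sign_mul_rpow_second_difference_nonneg hq hσ' (F := F - z) (a := 0) (b := 2 * z)
      (by linarith) le_rfl (by linarith)
    have h2 := sign_mul_rpow_second_difference_nonneg hq hσ' (F := z) (a := 0) (b := z)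
      hz.le le_rfl hz.le
    rw [Real.zero_rpow hq.ne', show F - z + 2 * z = F + z by ring, add_zero, add_zero] at h1
    rw [Real.zero_rpow hq.ne', ← two_mul, add_zero, add_zero] at h2
    linarith
  · have e : |F - z| ^ (p - 2) * (F - z) = -(z - F) ^ (p - 1) := by
      rw [← hpow (z - F) (by linarith), abs_sub_comm]; ring
    have h1 := sign_mul_rpow_second_difference_nonneg hq hσ' (F := F) (a := z - F) (b := z)
      hF (by linarith) (by linarith)
    rw [show F + (z - F) = z by ring] at h1
    rw [e]
    linarith

/-- Up to the sign of `p - 2`, for `X ≥ 1` the increment in `f` of `(F + f X)^p - (f X)^p` is at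
least `X` times its value at `X = 1`. -/
theorem monotoneOn_sign_mul_rpow_dilate {σ p F X : ℝ} (hp : 1 < p)
    (hσ : 0 ≤ σ * (p - 2)) (hF : 0 ≤ F) (hX : 1 ≤ X) :
    MonotoneOn (fun f : ℝ => σ * ((F + f * X) ^ p - (f * X) ^ p - X * ((F + f) ^ p - f ^ p)))
      (Ici 0) := by
  have hσ' : 0 ≤ σ * (p - 1 - 1) := by convert hσ using 2; ring
  have key : ∀ f : ℝ, HasDerivAt
      (fun f : ℝ => σ * ((F + f * X) ^ p - (f * X) ^ p - X * ((F + f) ^ p - f ^ p)))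
      (p * X * (σ * ((F + f * X) ^ (p - 1) - (f * X) ^ (p - 1) - (F + f) ^ (p - 1)
        + f ^ (p - 1)))) f := fun f => by
    have h0 := (hasDerivAt_id f).mul_const X
    have h1 : HasDerivAt (fun f : ℝ => (F + f * X) ^ p) (1 * X * p * (F + f * X) ^ (p - 1)) f :=
      (h0.const_add F).rpow_const (Or.inr hp.le)
    have h2 : HasDerivAt (fun f : ℝ => (f * X) ^ p) (1 * X * p * (f * X) ^ (p - 1)) f :=
      h0.rpow_const (Or.inr hp.le)
    have h3 : HasDerivAt (fun f : ℝ => (F + f) ^ p) (1 * p * (F + f) ^ (p - 1)) f :=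
      ((hasDerivAt_id f).const_add F).rpow_const (Or.inr hp.le)
    have h4 : HasDerivAt (fun f : ℝ => f ^ p) (1 * p * f ^ (p - 1)) f :=
      (hasDerivAt_id f).rpow_const (Or.inr hp.le)
    exact (((h1.sub h2).sub ((h3.sub h4).const_mul X)).const_mul σ).congr_deriv (by ring)
  refine monotoneOn_of_deriv_nonneg (convex_Ici 0)
    (fun z _ => (key z).continuousAt.continuousWithinAt)
    (fun z _ => (key z).differentiableAt.differentiableWithinAt) fun f hf => ?_
  rw [interior_Ici, mem_Ioi] at hf
  rw [(key f).deriv]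
  exact mul_nonneg (by nlinarith) (sign_mul_rpow_second_difference_nonneg (by linarith) hσ' hF
    hf.le (by nlinarith))

theorem antitoneOn_sign_mul_rpow_dilate {σ p F X : ℝ} (hp : 1 < p)
    (hσ : 0 ≤ σ * (p - 2)) (hF : 0 ≤ F) (hX0 : 0 ≤ X) (hX : X ≤ 1) :
    AntitoneOn (fun f : ℝ => σ * ((F + f * X) ^ p - (f * X) ^ p - X * ((F + f) ^ p - f ^ p)))
      (Ici 0) := by
  rcases hX0.eq_or_lt with rfl | hX0
  · have h0 : (0 : ℝ) ^ p = 0 := Real.zero_rpow (by linarith)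
    intro a _ b _ _
    simp [h0]
  -- the substitution `f ↦ f / X`, `X ↦ 1 / X` reverses the roles of the two differences
  intro a ha b hb hab
  have h := monotoneOn_sign_mul_rpow_dilate hp hσ hF (X := 1 / X) (by rwa [one_le_div hX0])
    (a := a * X) (b := b * X) (mul_nonneg ha hX0.le) (mul_nonneg hb hX0.le)
    (mul_le_mul_of_nonneg_right hab hX0.le)
  have e : ∀ c : ℝ, c * X * (1 / X) = c := fun c => by field_simp
  simp only [e] at h
  have h' := mul_le_mul_of_nonneg_left h hX0.le
  have e2 : ∀ c d : ℝ, X * (σ * (c - 1 / X * d)) = σ * (X * c - d) := fun c d => by field_simp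
  rw [e2, e2] at h'
  simp only
  linarith

/-- If `D` is nonpositive on `[0,1]`, nonnegative on `[1,∞)` and its even part is nonnegative,
then its mean against the centred exponential law is nonnegative. -/
theorem integral_exp_neg_mul_nonneg_of_sign_change {D : ℝ → ℝ} (hDc : Continuous D)
    (hDi : IntegrableOn (fun s => Real.exp (-s) * D (s - 1)) (Ioi 0))
    (heven : ∀ X, 0 ≤ X → 0 ≤ D X + D (-X))
    (hneg : ∀ X, 0 ≤ X → X ≤ 1 → D X ≤ 0) (hpos : ∀ X, 1 ≤ X → 0 ≤ D X) :
    0 ≤ ∫ s in Ioi (0 : ℝ), Real.exp (-s) * D (s - 1) := by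
  have hcont : Continuous fun s => Real.exp (-s) * D (s - 1) := by fun_prop
  have hsplit : ∫ s in Ioi (0 : ℝ), Real.exp (-s) * D (s - 1)
      = (∫ s in (0 : ℝ)..1, Real.exp (-s) * D (s - 1))
        + (∫ s in (1 : ℝ)..2, Real.exp (-s) * D (s - 1))
        + ∫ s in Ioi (2 : ℝ), Real.exp (-s) * D (s - 1) := by
    rw [intervalIntegral.integral_add_adjacent_intervals (hcont.intervalIntegrable _ _)
      (hcont.intervalIntegrable _ _),
      intervalIntegral.integral_interval_add_Ioi hDi
        (hDi.mono_set (Ioi_subset_Ioi (zero_le_two (α := ℝ))))]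
  have h1 : ∫ s in (0 : ℝ)..1, Real.exp (-s) * D (s - 1)
      = ∫ s in (0 : ℝ)..1, Real.exp (s - 1) * D (-s) := by
    have := intervalIntegral.integral_comp_sub_left (a := 0) (b := 1)
      (fun s => Real.exp (-s) * D (s - 1)) 1
    rw [sub_self, sub_zero] at this
    rw [← this]
    refine intervalIntegral.integral_congr fun s _ => ?_
    congr 2 <;> ring
  have h2 : ∫ s in (1 : ℝ)..2, Real.exp (-s) * D (s - 1)
      = ∫ s in (0 : ℝ)..1, Real.exp (-s - 1) * D s := by
    have := intervalIntegral.integral_comp_add_right (a := 0) (b := 1)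
      (fun s => Real.exp (-s) * D (s - 1)) 1
    rw [zero_add, one_add_one_eq_two] at this
    rw [← this]
    refine intervalIntegral.integral_congr fun s _ => ?_
    congr 2 <;> ring
  have hc1 : Continuous fun s => Real.exp (s - 1) * D (-s) := by fun_prop
  have hc2 : Continuous fun s => Real.exp (-s - 1) * D s := by fun_prop
  rw [hsplit, h1, h2, ← intervalIntegral.integral_add (hc1.intervalIntegrable _ _)
    (hc2.intervalIntegrable _ _)]
  refine add_nonneg (intervalIntegral.integral_nonneg zero_le_one fun s hs => ?_)
    (setIntegral_nonneg measurableSet_Ioi fun s hs => ?_)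
  · have e1 : Real.exp (-s - 1) ≤ Real.exp (s - 1) :=
      Real.exp_le_exp.2 (by linarith [hs.1])
    have e2 := heven s hs.1
    have e3 := hneg s hs.1 hs.2
    have e4 := Real.exp_pos (s - 1)
    nlinarith
  · exact mul_nonneg (Real.exp_pos _).le (hpos _ (by linarith [mem_Ioi.1 hs]))

theorem integrableOn_exp_neg_mul_sub_one :
    IntegrableOn (fun s : ℝ => Real.exp (-s) * (s - 1)) (Ioi 0) := by
  have h1 := Real.GammaIntegral_convergent (s := 2) (by norm_num)
  have h2 := Real.GammaIntegral_convergent (s := 1) (by norm_num)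
  refine IntegrableOn.congr_fun (h1.sub h2) (fun s _ => ?_) measurableSet_Ioi
  have : (2 : ℝ) - 1 = 1 := by norm_num
  simp [this]; ring

theorem integral_exp_neg_mul_sub_one :
    ∫ s in Ioi (0 : ℝ), Real.exp (-s) * (s - 1) = 0 := by
  have h1 := Real.GammaIntegral_convergent (s := 2) (by norm_num)
  have h2 := Real.GammaIntegral_convergent (s := 1) (by norm_num)
  have h := integral_sub h1 h2
  rw [← Real.Gamma_eq_integral (by norm_num), ← Real.Gamma_eq_integral (by norm_num),
    Real.Gamma_two, Real.Gamma_one, sub_self] at h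
  refine Eq.trans ?_ h
  refine setIntegral_congr_fun measurableSet_Ioi fun s _ => ?_
  have : (2 : ℝ) - 1 = 1 := by norm_num
  simp [this]; ring

theorem integrableOn_exp_neg_mul_add_two_rpow {p : ℝ} (hp : 0 < p) :
    IntegrableOn (fun s : ℝ => Real.exp (-s) * (s + 2) ^ p) (Ioi 0) := by
  have h1 := (Real.GammaIntegral_convergent (s := p + 1) (by linarith)).const_mul (2 ^ p)
  have h2 := (Real.GammaIntegral_convergent (s := 1) (by norm_num)).const_mul (2 ^ p * 2 ^ p)
  refine Integrable.mono' (h1.add h2) ?_ ?_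
  · refine ContinuousOn.aestronglyMeasurable (fun s hs => ?_) measurableSet_Ioi
    have : ContinuousAt (fun s : ℝ => (s + 2) ^ p) s :=
      (continuousAt_id.add continuousAt_const).rpow_const (Or.inr hp.le)
    exact ((by fun_prop : ContinuousAt (fun s : ℝ => Real.exp (-s)) s).mul
      this).continuousWithinAt
  · refine (ae_restrict_iff' measurableSet_Ioi).2 (Filter.Eventually.of_forall fun s hs => ?_)
    have hs0 : 0 < s := hs
    have e : (s + 2) ^ p ≤ 2 ^ p * s ^ p + 2 ^ p * 2 ^ p := by
      rw [← Real.mul_rpow (by norm_num) hs0.le, ← Real.mul_rpow (by norm_num) (by norm_num)]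
      rcases le_total s 2 with h | h
      · have : (s + 2) ^ p ≤ (2 * 2) ^ p := Real.rpow_le_rpow (by linarith) (by linarith) hp.le
        have h0 : 0 ≤ (2 * s) ^ p := by positivity
        linarith
      · have : (s + 2) ^ p ≤ (2 * s) ^ p := Real.rpow_le_rpow (by linarith) (by linarith) hp.le
        have h0 : (0 : ℝ) ≤ (2 * 2) ^ p := by positivity
        linarith
    rw [Real.norm_of_nonneg (by positivity)]
    simp only [Pi.add_apply, add_sub_cancel_right, sub_self, Real.rpow_zero]
    have := mul_le_mul_of_nonneg_left e (Real.exp_pos (-s)).le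
    linarith

theorem abs_add_mul_rpow_le {p F f M s : ℝ} (hp : 0 < p) (hF : |F| ≤ M) (hf : |f| ≤ M)
    (hs : 0 < s) : |F + f * (s - 1)| ^ p ≤ M ^ p * (s + 2) ^ p := by
  have hM : 0 ≤ M := (abs_nonneg _).trans hF
  rw [← Real.mul_rpow hM (by linarith)]
  refine Real.rpow_le_rpow (abs_nonneg _) ?_ hp.le
  have h1 : |s - 1| ≤ s + 1 := abs_le.2 ⟨by linarith, by linarith⟩
  calc |F + f * (s - 1)| ≤ |F| + |f * (s - 1)| := abs_add_le _ _
    _ = |F| + |f| * |s - 1| := by rw [abs_mul]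
    _ ≤ M + M * (s + 1) := by gcongr
    _ = M * (s + 2) := by ring

theorem continuous_exp_neg_mul_abs_rpow {p : ℝ} (hp : 0 < p) (F f : ℝ) :
    Continuous fun s : ℝ => Real.exp (-s) * |F + f * (s - 1)| ^ p := by
  have : Continuous fun s : ℝ => |F + f * (s - 1)| ^ p :=
    (by fun_prop : Continuous fun s : ℝ => |F + f * (s - 1)|).rpow_const fun _ => Or.inr hp.le
  fun_prop

theorem integrableOn_exp_neg_mul_abs_rpow {p : ℝ} (hp : 0 < p) (F f : ℝ) :
    IntegrableOn (fun s : ℝ => Real.exp (-s) * |F + f * (s - 1)| ^ p) (Ioi 0) := by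
  refine Integrable.mono' ((integrableOn_exp_neg_mul_add_two_rpow hp).const_mul
    ((max |F| |f|) ^ p)) (continuous_exp_neg_mul_abs_rpow hp F f).aestronglyMeasurable ?_
  refine (ae_restrict_iff' measurableSet_Ioi).2 (Filter.Eventually.of_forall fun s hs => ?_)
  rw [Real.norm_of_nonneg (by positivity)]
  have := mul_le_mul_of_nonneg_left (abs_add_mul_rpow_le hp (le_max_left |F| |f|)
    (le_max_right |F| |f|) hs) (Real.exp_pos (-s)).le
  linarith

/-- The moment `E |F + f (S - 1)|^p` for an exponentially distributed `S`. -/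
noncomputable def expMoment (p F f : ℝ) : ℝ :=
  ∫ s in Ioi (0 : ℝ), Real.exp (-s) * |F + f * (s - 1)| ^ p

theorem expMoment_nonneg (p F f : ℝ) : 0 ≤ expMoment p F f :=
  setIntegral_nonneg measurableSet_Ioi fun _ _ => by positivity

theorem expMoment_le {p F f M : ℝ} (hp : 0 < p) (hF : |F| ≤ M) (hf : |f| ≤ M) :
    expMoment p F f ≤ M ^ p * ∫ s in Ioi (0 : ℝ), Real.exp (-s) * (s + 2) ^ p := by
  rw [expMoment, ← integral_const_mul]
  refine setIntegral_mono_on (integrableOn_exp_neg_mul_abs_rpow hp F f)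
    ((integrableOn_exp_neg_mul_add_two_rpow hp).const_mul _) measurableSet_Ioi fun s hs => ?_
  have := mul_le_mul_of_nonneg_left (abs_add_mul_rpow_le hp hF hf hs) (Real.exp_pos (-s)).le
  linarith

theorem expMoment_zero_left {p f : ℝ} (hf : 0 ≤ f) :
    expMoment p 0 f = f ^ p * expMoment p 0 1 := by
  rw [expMoment, expMoment, ← integral_const_mul]
  refine setIntegral_congr_fun measurableSet_Ioi fun s _ => ?_
  simp only [zero_add, one_mul, abs_mul, abs_of_nonneg hf]
  rw [Real.mul_rpow hf (abs_nonneg _)]; ring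

theorem expMoment_pos {p : ℝ} (hp : 0 < p) : 0 < expMoment p 0 1 := by
  refine (setIntegral_pos_iff_support_of_nonneg_ae
    (Filter.Eventually.of_forall fun s => by positivity)
    (integrableOn_exp_neg_mul_abs_rpow hp 0 1)).2 ?_
  refine lt_of_lt_of_le (b := volume (Ioo (1 : ℝ) 2)) (by simp) (measure_mono fun s hs => ?_)
  refine ⟨?_, mem_Ioi.2 (by linarith [hs.1])⟩
  have : 0 < |0 + 1 * (s - 1)| := abs_pos.2 (by linarith [hs.1])
  exact (mul_pos (Real.exp_pos _) (Real.rpow_pos_of_pos this _)).ne'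

theorem continuousOn_expMoment {p a b : ℝ} (hp : 0 < p) {F f : ℝ → ℝ}
    (hF : ContinuousOn F (Icc a b)) (hf : ContinuousOn f (Icc a b)) :
    ContinuousOn (fun x => expMoment p (F x) (f x)) (Icc a b) := by
  obtain ⟨M₁, hM₁⟩ := isCompact_Icc.exists_bound_of_continuousOn hF
  obtain ⟨M₂, hM₂⟩ := isCompact_Icc.exists_bound_of_continuousOn hf
  refine continuousOn_of_dominated
    (bound := fun s => (max M₁ M₂) ^ p * (Real.exp (-s) * (s + 2) ^ p))
    (fun x _ => (continuous_exp_neg_mul_abs_rpow hp (F x) (f x)).aestronglyMeasurable)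
    (fun x hx => ?_) ((integrableOn_exp_neg_mul_add_two_rpow hp).const_mul _) ?_
  · refine (ae_restrict_iff' measurableSet_Ioi).2 (Filter.Eventually.of_forall fun s hs => ?_)
    rw [Real.norm_of_nonneg (by positivity)]
    have := mul_le_mul_of_nonneg_left (abs_add_mul_rpow_le hp ((hM₁ x hx).trans (le_max_left _ M₂))
      ((hM₂ x hx).trans (le_max_right M₁ _)) hs) (Real.exp_pos (-s)).le
    linarith
  · refine Filter.Eventually.of_forall fun s => ?_
    have : ContinuousOn (fun x => |F x + f x * (s - 1)| ^ p) (Icc a b) :=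
      ((hF.add (hf.mul continuousOn_const)).abs).rpow_const fun _ _ => Or.inr hp.le
    exact continuousOn_const.mul this

/-- The moment gap `E |F + f X|^p - E |f X|^p`, with `X` a centred exponential variable, is
increasing in `f` for `p ≥ 2` and decreasing for `p ≤ 2`. -/
theorem monotoneOn_sign_mul_expMoment_sub {σ p F : ℝ} (hp : 1 < p) (hσ : 0 ≤ σ * (p - 2))
    (hF : 0 ≤ F) :
    MonotoneOn (fun f => σ * (expMoment p F f - expMoment p 0 1 * f ^ p)) (Ici 0) := by
  intro f₁ hf₁ f₂ hf₂ h12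
  rw [mem_Ici] at hf₁ hf₂
  have hp0 : 0 < p := by linarith
  set D : ℝ → ℝ := fun X =>
    σ * (|F + f₂ * X| ^ p - |F + f₁ * X| ^ p - |0 + f₂ * X| ^ p + |0 + f₁ * X| ^ p) with hD
  have hDc : Continuous D := by
    have : ∀ A B : ℝ, Continuous fun X : ℝ => |A + B * X| ^ p := fun A B =>
      (by fun_prop : Continuous fun X : ℝ => |A + B * X|).rpow_const fun _ => Or.inr hp0.le
    have h1 := this F f₂
    have h2 := this F f₁
    have h3 := this 0 f₂
    have h4 := this 0 f₁
    rw [hD]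
    fun_prop
  have hi := integrableOn_exp_neg_mul_abs_rpow hp0
  have hDi' : IntegrableOn (fun s => σ * (Real.exp (-s) * |F + f₂ * (s - 1)| ^ p
      - Real.exp (-s) * |F + f₁ * (s - 1)| ^ p - Real.exp (-s) * |0 + f₂ * (s - 1)| ^ p
      + Real.exp (-s) * |0 + f₁ * (s - 1)| ^ p)) (Ioi 0) :=
    ((((hi F f₂).sub (hi F f₁)).sub (hi 0 f₂)).add (hi 0 f₁)).const_mul σ
  have heq : ∀ s, Real.exp (-s) * D (s - 1) = σ * (Real.exp (-s) * |F + f₂ * (s - 1)| ^ p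
      - Real.exp (-s) * |F + f₁ * (s - 1)| ^ p - Real.exp (-s) * |0 + f₂ * (s - 1)| ^ p
      + Real.exp (-s) * |0 + f₁ * (s - 1)| ^ p) := fun s => by simp only [hD]; ring
  have hDi : IntegrableOn (fun s => Real.exp (-s) * D (s - 1)) (Ioi 0) := by
    simpa only [heq] using hDi'
  have hint : ∫ s in Ioi (0 : ℝ), Real.exp (-s) * D (s - 1)
      = σ * (expMoment p F f₂ - expMoment p F f₁ - f₂ ^ p * expMoment p 0 1
        + f₁ ^ p * expMoment p 0 1) := by
    rw [← expMoment_zero_left hf₁, ← expMoment_zero_left hf₂]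
    simp only [heq]
    have hi1 := (hi F f₂).sub (hi F f₁)
    have hi2 := hi1.sub (hi 0 f₂)
    have e1 := integral_sub (hi F f₂) (hi F f₁)
    have e2 := integral_sub hi1 (hi 0 f₂)
    have e3 := integral_add hi2 (hi 0 f₁)
    simp only [Pi.sub_apply] at e2 e3
    rw [integral_const_mul, e3, e2, e1]
    rfl
  -- subtracting the linear function `D 1 * X`, of mean zero, produces the sign change at `X = 1`
  have hlin : ∀ s, Real.exp (-s) * (D (s - 1) - D 1 * (s - 1))
      = Real.exp (-s) * D (s - 1) - D 1 * (Real.exp (-s) * (s - 1)) := fun s => by ring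
  have hgoal := integral_exp_neg_mul_nonneg_of_sign_change (D := fun X => D X - D 1 * X)
    (by fun_prop) ?_ ?_ ?_ ?_
  · simp only [hlin] at hgoal
    rw [integral_sub hDi (integrableOn_exp_neg_mul_sub_one.const_mul _), integral_const_mul,
      integral_exp_neg_mul_sub_one, hint] at hgoal
    simp only
    linarith
  · simp only [hlin]
    exact hDi.sub (integrableOn_exp_neg_mul_sub_one.const_mul _)
  · intro X hX
    have h := monotoneOn_sign_mul_abs_rpow_symm hp hσ hF (a := f₁ * X) (b := f₂ * X)
      (mul_nonneg hf₁ hX) (mul_nonneg hf₂ hX) (mul_le_mul_of_nonneg_right h12 hX)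
    have e : ∀ y : ℝ, F + -y = F - y := fun y => (sub_eq_add_neg _ _).symm
    have e1 : |f₁ * X| = f₁ * X := abs_of_nonneg (mul_nonneg hf₁ hX)
    have e2 : |f₂ * X| = f₂ * X := abs_of_nonneg (mul_nonneg hf₂ hX)
    simp only [hD, zero_add, mul_neg, abs_neg, e, e1, e2]
    simp only at h
    linarith
  · intro X hX hX1
    have h := antitoneOn_sign_mul_rpow_dilate hp hσ hF hX hX1 hf₁ hf₂ h12
    simp only [hD, zero_add, mul_one]
    rw [abs_of_nonneg (by positivity), abs_of_nonneg (by positivity),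
      abs_of_nonneg (by positivity), abs_of_nonneg (by positivity), abs_of_nonneg (by positivity),
      abs_of_nonneg (by positivity), abs_of_nonneg (by positivity), abs_of_nonneg (by positivity)]
    simp only at h
    linarith
  · intro X hX1
    have hX : 0 ≤ X := by linarith
    have h := monotoneOn_sign_mul_rpow_dilate hp hσ hF hX1 hf₁ hf₂ h12
    simp only [hD, zero_add, mul_one]
    rw [abs_of_nonneg (by positivity), abs_of_nonneg (by positivity),
      abs_of_nonneg (by positivity), abs_of_nonneg (by positivity), abs_of_nonneg (by positivity),
      abs_of_nonneg (by positivity), abs_of_nonneg (by positivity), abs_of_nonneg (by positivity)]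
    simp only at h
    linarith

/-- The translation `s ↦ s + F / f` of the exponential law makes the dependence on `F` explicit. -/
theorem expMoment_eq_tail {p F f : ℝ} (hf : 0 < f) :
    expMoment p F f
      = f ^ p * (Real.exp (F / f) * ∫ s in Ioi (F / f), Real.exp (-s) * |s - 1| ^ p) := by
  have h := (measurePreserving_add_right volume (F / f)).setIntegral_preimage_emb
    (measurableEmbedding_addRight (F / f)) (fun s => Real.exp (-s) * |s - 1| ^ p) (Ioi (F / f))
  rw [preimage_add_const_Ioi, sub_self] at h
  rw [← h, expMoment, ← integral_const_mul, ← integral_const_mul]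
  refine setIntegral_congr_fun measurableSet_Ioi fun s _ => ?_
  have e1 : F + f * (s - 1) = f * (s + F / f - 1) := by field_simp; ring
  have e2 : Real.exp (-s) = Real.exp (F / f) * Real.exp (-(s + F / f)) := by
    rw [← Real.exp_add]; ring_nf
  rw [e1, e2, abs_mul, abs_of_pos hf, Real.mul_rpow hf.le (abs_nonneg _)]
  ring

/-- For fixed `f > 0` the moment solves `U - f ∂U/∂F = |F - f|^p`. -/
theorem hasDerivAt_expMoment {p F f : ℝ} (hp : 0 < p) (hf : 0 < f) (hF : 0 < F) :
    HasDerivAt (fun F => expMoment p F f) ((expMoment p F f - |F - f| ^ p) / f) F := by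
  set u : ℝ → ℝ := fun s => Real.exp (-s) * |s - 1| ^ p with hu
  have huc : Continuous u := by
    simpa [hu] using continuous_exp_neg_mul_abs_rpow hp 0 1
  have hui : IntegrableOn u (Ioi 0) := by
    simpa [hu] using integrableOn_exp_neg_mul_abs_rpow hp 0 1
  have hK : ∀ r : ℝ, 0 < r → ∫ s in Ioi r, u s = (∫ s in Ioi 0, u s) - ∫ s in (0 : ℝ)..r, u s :=
    fun r hr => by
      rw [← intervalIntegral.integral_interval_add_Ioi hui
        (hui.mono_set (Ioi_subset_Ioi hr.le))]
      ring
  have hd : HasDerivAt (fun r => ∫ s in Ioi r, u s) (-u (F / f)) (F / f) := by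
    have h1 : HasDerivAt (fun r => (∫ s in Ioi 0, u s) - ∫ s in (0 : ℝ)..r, u s)
        (-u (F / f)) (F / f) :=
      (intervalIntegral.integral_hasDerivAt_right (huc.intervalIntegrable _ _)
        (huc.stronglyMeasurableAtFilter _ _) huc.continuousAt).const_sub _
    refine h1.congr_of_eventuallyEq ?_
    filter_upwards [lt_mem_nhds (div_pos hF hf)] with r hr using hK r hr
  have hr : HasDerivAt (fun F : ℝ => F / f) (1 / f) F := (hasDerivAt_id F).div_const f
  have h := (hr.exp.mul (hd.comp F hr)).const_mul (f ^ p)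
  have heq : (fun F => expMoment p F f) = fun F => f ^ p *
      (Real.exp (F / f) * ((fun r => ∫ s in Ioi r, u s) ∘ fun F => F / f) F) :=
    funext fun F => expMoment_eq_tail hf
  rw [heq]
  refine h.congr_deriv ?_
  have e : f ^ p * |F / f - 1| ^ p = |F - f| ^ p := by
    have : |F / f - 1| = |F - f| / f := by
      rw [← abs_of_pos hf, ← abs_div, abs_of_pos hf, sub_div, div_self hf.ne']
    rw [this, Real.div_rpow (abs_nonneg _) hf.le]
    field_simp
  have e2 : Real.exp (F / f) * Real.exp (-(F / f)) = 1 := by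
    rw [← Real.exp_add, add_neg_cancel, Real.exp_zero]
  rw [← e, expMoment_eq_tail hf]
  simp only [hu, Function.comp_apply]
  generalize |F / f - 1| ^ p = A
  linear_combination (-(f ^ p * A / f)) * e2

open Filter Topology

/-! ### Integral inequalities for a pair of real functions -/

/-- A finite interval estimate whose boundary terms vanish at `0` and `∞` passes to `(0,∞)`. -/
theorem lintegral_Ioi_le_of_forall_interval {u v E : ℝ → ℝ} (hu : ContinuousOn u (Ioi 0))
    (hv : ContinuousOn v (Ioi 0)) (hu0 : ∀ x, 0 ≤ u x) (hv0 : ∀ x, 0 ≤ v x)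
    (h : ∀ a b : ℝ, 0 < a → a ≤ b → ∫ x in a..b, u x ≤ (∫ x in a..b, v x) + (E b - E a))
    (hE0 : Tendsto E (𝓝[>] 0) (𝓝 0)) (hEt : Tendsto E atTop (𝓝 0)) :
    ∫⁻ x in Ioi (0 : ℝ), ENNReal.ofReal (u x) ≤ ∫⁻ x in Ioi (0 : ℝ), ENNReal.ofReal (v x) := by
  set a : ℕ → ℝ := fun n => 1 / ((n : ℝ) + 1) with ha_def
  set b : ℕ → ℝ := fun n => (n : ℝ) + 1 with hb_def
  have ha : Tendsto a atTop (𝓝 0) := tendsto_one_div_add_atTop_nhds_zero_nat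
  have hb : Tendsto b atTop atTop :=
    tendsto_atTop_add_const_right _ _ tendsto_natCast_atTop_atTop
  have ha0 : ∀ n, 0 < a n := fun n => by positivity
  have hab : ∀ n, a n ≤ b n := fun n => by
    have h1 : (1 : ℝ) ≤ (n : ℝ) + 1 := by linarith [Nat.cast_nonneg (α := ℝ) n]
    exact ((div_le_one (by positivity)).2 h1).trans h1
  have hcov : AECover (volume.restrict (Ioi (0 : ℝ))) atTop fun n => Ioi (a n) ∩ Iic (b n) :=
    (aecover_Ioi_of_Ioi ha).inter (aecover_Iic hb)
  have hmeas : ∀ w : ℝ → ℝ, ContinuousOn w (Ioi 0) →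
      AEMeasurable (fun x => ENNReal.ofReal (w x)) (volume.restrict (Ioi (0 : ℝ))) :=
    fun w hw => (hw.aemeasurable measurableSet_Ioi).ennreal_ofReal
  have hint : ∀ w : ℝ → ℝ, ContinuousOn w (Ioi 0) → (∀ x, 0 ≤ w x) → ∀ n,
      ∫⁻ x in Ioi (a n) ∩ Iic (b n), ENNReal.ofReal (w x) ∂(volume.restrict (Ioi (0 : ℝ)))
        = ENNReal.ofReal (∫ x in (a n)..(b n), w x) := fun w hw hw0 n => by
    have hsub : Icc (a n) (b n) ⊆ Ioi 0 := fun x hx => lt_of_lt_of_le (ha0 n) hx.1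
    have hsub' : Ioc (a n) (b n) ⊆ Ioi 0 := Ioc_subset_Icc_self.trans hsub
    rw [Ioi_inter_Iic, Measure.restrict_restrict measurableSet_Ioc,
      inter_eq_self_of_subset_left hsub', intervalIntegral.integral_of_le (hab n),
      ofReal_integral_eq_lintegral_ofReal
        (((hw.mono hsub).integrableOn_Icc).mono_set Ioc_subset_Icc_self)
        (Eventually.of_forall hw0)]
  have hlim := hcov.lintegral_tendsto_of_countably_generated (hmeas u hu)
  have hlim2 : Tendsto (fun n => (∫⁻ x in Ioi (0 : ℝ), ENNReal.ofReal (v x))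
      + ENNReal.ofReal (E (b n) - E (a n))) atTop
      (𝓝 ((∫⁻ x in Ioi (0 : ℝ), ENNReal.ofReal (v x)) + ENNReal.ofReal (0 - 0))) := by
    refine Tendsto.add tendsto_const_nhds (ENNReal.tendsto_ofReal ?_)
    exact (hEt.comp hb).sub (hE0.comp (tendsto_nhdsWithin_iff.2
      ⟨ha, Eventually.of_forall fun n => ha0 n⟩))
  rw [sub_zero, ENNReal.ofReal_zero, add_zero] at hlim2
  refine le_of_tendsto_of_tendsto' hlim hlim2 fun n => ?_
  rw [hint u hu hu0 n]
  refine (ENNReal.ofReal_le_ofReal (h _ _ (ha0 n) (hab n))).trans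
    (ENNReal.ofReal_add_le.trans ?_)
  gcongr
  rw [← hint v hv hv0 n]
  exact setLIntegral_le_lintegral _ _

/-- The real-variable data of the problem: `f` plays the role of `H^* g`, a continuous decreasing
function, and `F` that of `H^* f`, with `p`-th powers vanishing like `o(1/x)` at both ends. -/
structure IsHardyPair (p : ℝ) (f F : ℝ → ℝ) : Prop where
  nonneg : ∀ x, 0 ≤ f x
  nonneg' : ∀ x, 0 ≤ F x
  anti : AntitoneOn f (Ioi 0)
  cont : ContinuousOn f (Ioi 0)
  deriv : ∀ x, 0 < x → HasDerivAt F (-(f x / x)) x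
  zero : ∀ x, 0 < x → f x = 0 → F x = 0
  lim_zero : Tendsto (fun x => x * f x ^ p) (𝓝[>] 0) (𝓝 0)
  lim_top : Tendsto (fun x => x * f x ^ p) atTop (𝓝 0)
  lim_zero' : Tendsto (fun x => x * F x ^ p) (𝓝[>] 0) (𝓝 0)
  lim_top' : Tendsto (fun x => x * F x ^ p) atTop (𝓝 0)

namespace IsHardyPair

variable {p : ℝ} {f F : ℝ → ℝ}

theorem cont' (h : IsHardyPair p f F) : ContinuousOn F (Ioi 0) :=
  fun x hx => (h.deriv x hx).continuousAt.continuousWithinAt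

theorem pos' (h : IsHardyPair p f F) {x : ℝ} (hx : 0 < x) (hf : 0 < f x) : 0 < F x := by
  refine (h.nonneg' x).lt_of_ne fun h0 => ?_
  have hmin : IsLocalMin F x := Eventually.of_forall fun y => h0 ▸ h.nonneg' y
  have := hmin.hasDerivAt_eq_zero (h.deriv x hx)
  have h2 : 0 < f x / x := div_pos hf hx
  linarith

theorem continuousOn_rpow (h : IsHardyPair p f F) (hp : 0 < p) :
    ContinuousOn (fun x => f x ^ p) (Ioi 0) :=
  h.cont.rpow_const fun _ _ => Or.inr hp.le

theorem continuousOn_abs_sub_rpow (h : IsHardyPair p f F) (hp : 0 < p) :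
    ContinuousOn (fun x => |F x - f x| ^ p) (Ioi 0) :=
  ((h.cont'.sub h.cont).abs).rpow_const fun _ _ => Or.inr hp.le

theorem intervalIntegrable {w : ℝ → ℝ} (hw : ContinuousOn w (Ioi 0)) {a b : ℝ} (ha : 0 < a)
    (hab : a ≤ b) : IntervalIntegrable w volume a b :=
  (hw.mono fun _ hx => lt_of_lt_of_le ha hx.1).intervalIntegrable_of_Icc hab

theorem hasDerivAt_mul_rpow (h : IsHardyPair p f F) (hp : 1 < p) {x : ℝ} (hx : 0 < x) :
    HasDerivAt (fun x => x * F x ^ p) (F x ^ p - p * f x * F x ^ (p - 1)) x := by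
  have := (hasDerivAt_id x).mul ((h.deriv x hx).rpow_const (p := p) (Or.inr hp.le))
  refine this.congr_deriv ?_
  simp only [id]
  field_simp
  ring

theorem continuousOn_deriv_mul_rpow (h : IsHardyPair p f F) (hp : 1 < p) :
    ContinuousOn (fun x => F x ^ p - p * f x * F x ^ (p - 1)) (Ioi 0) := by
  have h1 : ContinuousOn (fun x => F x ^ p) (Ioi 0) :=
    h.cont'.rpow_const fun _ _ => Or.inr (by linarith)
  have h2 : ContinuousOn (fun x => F x ^ (p - 1)) (Ioi 0) :=
    h.cont'.rpow_const fun _ _ => Or.inr (by linarith)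
  exact h1.sub ((continuousOn_const.mul h.cont).mul h2)

theorem integral_deriv_mul_rpow (h : IsHardyPair p f F) (hp : 1 < p) {a b : ℝ} (ha : 0 < a)
    (hab : a ≤ b) :
    ∫ x in a..b, (F x ^ p - p * f x * F x ^ (p - 1)) = b * F b ^ p - a * F a ^ p := by
  refine intervalIntegral.integral_eq_sub_of_hasDerivAt (f := fun x => x * F x ^ p)
    (fun x hx => ?_)
    (intervalIntegrable (h.continuousOn_deriv_mul_rpow hp) ha hab)
  rw [uIcc_of_le hab] at hx
  exact h.hasDerivAt_mul_rpow hp (lt_of_lt_of_le ha hx.1)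

/-- The upper bound with constant `p - 1`, for `p ≥ 2`. -/
theorem lintegral_abs_sub_rpow_le (h : IsHardyPair p f F) (hp : 2 ≤ p) :
    ∫⁻ x in Ioi (0 : ℝ), ENNReal.ofReal (|F x - f x| ^ p)
      ≤ ∫⁻ x in Ioi (0 : ℝ), ENNReal.ofReal ((p - 1) ^ p * f x ^ p) := by
  have hp1 : 1 < p := by linarith
  have hp0 : 0 < p := by linarith
  have hu := h.continuousOn_abs_sub_rpow hp0
  have hv : ContinuousOn (fun x => (p - 1) ^ p * f x ^ p) (Ioi 0) :=
    continuousOn_const.mul (h.continuousOn_rpow hp0)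
  have hw := h.continuousOn_deriv_mul_rpow hp1
  refine lintegral_Ioi_le_of_forall_interval (E := fun x => burkholderConst p * (x * F x ^ p))
    hu hv (fun x => by positivity)
    (fun x => mul_nonneg (Real.rpow_nonneg (by linarith) _) (Real.rpow_nonneg (h.nonneg x) _))
    (fun a b ha hab => ?_) (by simpa using h.lim_zero'.const_mul (burkholderConst p))
    (by simpa using h.lim_top'.const_mul (burkholderConst p))
  rw [← mul_sub, ← h.integral_deriv_mul_rpow hp1 ha hab, ← intervalIntegral.integral_const_mul,
    ← intervalIntegral.integral_add (intervalIntegrable hv ha hab)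
      ((intervalIntegrable hw ha hab).const_mul _)]
  exact intervalIntegral.integral_mono_on hab (intervalIntegrable hu ha hab)
    ((intervalIntegrable hv ha hab).add ((intervalIntegrable hw ha hab).const_mul _))
    fun x _ => burkholder_le hp (h.nonneg x) (h.nonneg' x)

/-- The lower bound with constant `p - 1`, for `p ≤ 2`. -/
theorem le_lintegral_abs_sub_rpow (h : IsHardyPair p f F) (hp1 : 1 < p) (hp : p ≤ 2) :
    ∫⁻ x in Ioi (0 : ℝ), ENNReal.ofReal ((p - 1) ^ p * f x ^ p)
      ≤ ∫⁻ x in Ioi (0 : ℝ), ENNReal.ofReal (|F x - f x| ^ p) := by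
  have hp0 : 0 < p := by linarith
  have hu := h.continuousOn_abs_sub_rpow hp0
  have hv : ContinuousOn (fun x => (p - 1) ^ p * f x ^ p) (Ioi 0) :=
    continuousOn_const.mul (h.continuousOn_rpow hp0)
  have hw := h.continuousOn_deriv_mul_rpow hp1
  refine lintegral_Ioi_le_of_forall_interval (E := fun x => -(burkholderConst p * (x * F x ^ p)))
    hv hu
    (fun x => mul_nonneg (Real.rpow_nonneg (by linarith) _) (Real.rpow_nonneg (h.nonneg x) _))
    (fun x => by positivity)
    (fun a b ha hab => ?_) (by simpa using (h.lim_zero'.const_mul (burkholderConst p)).neg)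
    (by simpa using (h.lim_top'.const_mul (burkholderConst p)).neg)
  suffices (∫ x in a..b, (p - 1) ^ p * f x ^ p)
      + burkholderConst p * (b * F b ^ p - a * F a ^ p) ≤ ∫ x in a..b, |F x - f x| ^ p by
    linarith
  rw [← h.integral_deriv_mul_rpow hp1 ha hab, ← intervalIntegral.integral_const_mul,
    ← intervalIntegral.integral_add (intervalIntegrable hv ha hab)
      ((intervalIntegrable hw ha hab).const_mul _)]
  exact intervalIntegral.integral_mono_on hab
    ((intervalIntegrable hv ha hab).add ((intervalIntegrable hw ha hab).const_mul _))
    (intervalIntegrable hu ha hab)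
    fun x _ => le_burkholder hp1 hp (h.nonneg x) (h.nonneg' x)

/-- The energy `x (E |F + f X|^p - E |f X|^p)`, with `X` a centred exponential variable. -/
noncomputable def energy (p : ℝ) (f F : ℝ → ℝ) (x : ℝ) : ℝ :=
  x * (expMoment p (F x) (f x) - expMoment p 0 1 * f x ^ p)

theorem continuousOn_energy (h : IsHardyPair p f F) (hp : 0 < p) {a b : ℝ} (ha : 0 < a) :
    ContinuousOn (energy p f F) (Icc a b) := by
  have hsub : Icc a b ⊆ Ioi 0 := fun x hx => lt_of_lt_of_le ha hx.1
  exact continuousOn_id.mul ((continuousOn_expMoment hp (h.cont'.mono hsub)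
    (h.cont.mono hsub)).sub (continuousOn_const.mul ((h.continuousOn_rpow hp).mono hsub)))

theorem abs_energy_le (h : IsHardyPair p f F) (hp : 0 < p) {x : ℝ} (hx : 0 < x) :
    |energy p f F x| ≤ (∫ s in Ioi (0 : ℝ), Real.exp (-s) * (s + 2) ^ p)
      * (x * F x ^ p + x * f x ^ p) + expMoment p 0 1 * (x * f x ^ p) := by
  set K := ∫ s in Ioi (0 : ℝ), Real.exp (-s) * (s + 2) ^ p
  have hf := h.nonneg x
  have hF := h.nonneg' x
  have hK : 0 ≤ K := setIntegral_nonneg measurableSet_Ioi fun s hs => by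
    have : (0 : ℝ) < s := hs
    positivity
  have hC := expMoment_nonneg p 0 1
  have h1 := expMoment_le hp (F := F x) (f := f x) (M := max (F x) (f x))
    (by rw [abs_of_nonneg hF]; exact le_max_left _ _)
    (by rw [abs_of_nonneg hf]; exact le_max_right _ _)
  have h2 : (max (F x) (f x)) ^ p ≤ F x ^ p + f x ^ p := by
    have h3 := Real.rpow_nonneg hf p
    have h4 := Real.rpow_nonneg hF p
    rcases max_choice (F x) (f x) with e | e <;> rw [e] <;> linarith
  have h3 := expMoment_nonneg p (F x) (f x)
  have h5 : expMoment p (F x) (f x) ≤ K * (F x ^ p + f x ^ p) := by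
    refine h1.trans ?_
    rw [mul_comm]
    gcongr
  have h6 : 0 ≤ expMoment p 0 1 * f x ^ p := mul_nonneg hC (Real.rpow_nonneg hf p)
  rw [energy, abs_mul, abs_of_pos hx]
  have h7 : |expMoment p (F x) (f x) - expMoment p 0 1 * f x ^ p|
      ≤ K * (F x ^ p + f x ^ p) + expMoment p 0 1 * f x ^ p := by
    rw [abs_le]; constructor <;> linarith
  calc _ ≤ x * (K * (F x ^ p + f x ^ p) + expMoment p 0 1 * f x ^ p) := by gcongr
    _ = _ := by ring

theorem tendsto_energy (h : IsHardyPair p f F) (hp : 0 < p) {l : Filter ℝ}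
    (hl : ∀ᶠ x in l, 0 < x) (h1 : Tendsto (fun x => x * f x ^ p) l (𝓝 0))
    (h2 : Tendsto (fun x => x * F x ^ p) l (𝓝 0)) : Tendsto (energy p f F) l (𝓝 0) := by
  refine squeeze_zero_norm' (hl.mono fun x hx => h.abs_energy_le hp hx) ?_
  simpa using ((h2.add h1).const_mul _).add (h1.const_mul _)

/-- The upper right Dini derivative of `σ` times the energy is at most
`σ (|F - f|^p - C_p f^p)`. -/
theorem eventually_slope_energy_lt {σ r x : ℝ} (h : IsHardyPair p f F) (hp : 1 < p)
    (hσ : 0 ≤ σ * (p - 2)) (hx : 0 < x)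
    (hr : σ * (|F x - f x| ^ p - expMoment p 0 1 * f x ^ p) < r) :
    ∀ᶠ z in 𝓝[>] x, slope (fun x => σ * energy p f F x) x z < r := by
  have hp0 : 0 < p := by linarith
  rcases (h.nonneg x).eq_or_lt with h0 | hpos
  · have hz : ∀ z, x ≤ z → energy p f F z = 0 := fun z hxz => by
      have hz0 : 0 < z := hx.trans_le hxz
      have e1 : f z = 0 :=
        le_antisymm (h0 ▸ h.anti (mem_Ioi.2 hx) (mem_Ioi.2 hz0) hxz) (h.nonneg z)
      rw [energy, e1, h.zero z hz0 e1, expMoment_zero_left le_rfl, Real.zero_rpow hp0.ne']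
      ring
    filter_upwards [self_mem_nhdsWithin] with z hz'
    rw [slope_def_field, hz z (mem_Ioi.1 hz').le, hz x le_rfl]
    rw [← h0, h.zero x hx h0.symm, sub_zero, abs_zero, Real.zero_rpow hp0.ne'] at hr
    simpa using hr
  -- freezing the second argument of the moment gap at `f x` majorizes the energy to the right of `x`
  set c := f x with hc
  set H : ℝ → ℝ := fun y => σ * (y * (expMoment p (F y) c - expMoment p 0 1 * c ^ p)) with hH
  have hHd : HasDerivAt H (σ * (|F x - c| ^ p - expMoment p 0 1 * c ^ p)) x := by
    have h1 : HasDerivAt (fun y => expMoment p (F y) c)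
        ((expMoment p (F x) c - |F x - c| ^ p) / c * (-(c / x))) x :=
      (hasDerivAt_expMoment hp0 hpos (h.pos' hx hpos)).comp x (h.deriv x hx)
    have h2 := ((hasDerivAt_id x).mul (h1.sub_const (expMoment p 0 1 * c ^ p))).const_mul σ
    refine h2.congr_deriv ?_
    simp only [id]
    field_simp
    ring
  have hlt := ((hasDerivAt_iff_tendsto_slope.1 hHd).mono_left
    (nhdsWithin_mono x (fun z (hz : x < z) => hz.ne'))).eventually (gt_mem_nhds hr)
  filter_upwards [hlt, self_mem_nhdsWithin] with z hz hxz
  rw [mem_Ioi] at hxz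
  refine lt_of_le_of_lt ?_ hz
  rw [slope_def_field, slope_def_field]
  have hz0 : 0 < z := hx.trans hxz
  have hm := monotoneOn_sign_mul_expMoment_sub hp hσ (h.nonneg' z) (mem_Ici.2 (h.nonneg z))
    (mem_Ici.2 hpos.le) (h.anti (mem_Ioi.2 hx) (mem_Ioi.2 hz0) hxz.le)
  have hm' := mul_le_mul_of_nonneg_left hm hz0.le
  refine div_le_div_of_nonneg_right ?_ (by linarith)
  simp only [hH, energy, ← hc]
  linarith

theorem sign_mul_energy_sub_le {σ a b : ℝ} (h : IsHardyPair p f F) (hp : 1 < p)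
    (hσ : 0 ≤ σ * (p - 2)) (ha : 0 < a) (hab : a ≤ b) :
    σ * (energy p f F b - energy p f F a)
      ≤ σ * ((∫ x in a..b, |F x - f x| ^ p) - ∫ x in a..b, expMoment p 0 1 * f x ^ p) := by
  have hp0 : 0 < p := by linarith
  have hu := h.continuousOn_abs_sub_rpow hp0
  have hv : ContinuousOn (fun x => expMoment p 0 1 * f x ^ p) (Ioi 0) :=
    continuousOn_const.mul (h.continuousOn_rpow hp0)
  set v : ℝ → ℝ := fun x => σ * (|F x - f x| ^ p - expMoment p 0 1 * f x ^ p) with hv_def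
  have hvc : ContinuousOn v (Ioi 0) := continuousOn_const.mul (hu.sub hv)
  have hBd : ∀ x ∈ Icc a b, HasDerivAt
      (fun x => σ * energy p f F a + ∫ t in a..x, v t) (v x) x := fun x hx => by
    have hx0 : 0 < x := lt_of_lt_of_le ha hx.1
    have hat := hvc.continuousAt (Ioi_mem_nhds hx0)
    exact (intervalIntegral.integral_hasDerivAt_right (intervalIntegrable hvc ha hx.1)
      (hvc.stronglyMeasurableAtFilter isOpen_Ioi x hx0) hat).const_add _
  have := image_le_of_liminf_slope_right_le_deriv_boundary
    (continuousOn_const.mul (h.continuousOn_energy hp0 ha) :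
      ContinuousOn (fun x => σ * energy p f F x) (Icc a b))
    (by simp) (fun x hx => (hBd x hx).continuousAt.continuousWithinAt)
    (fun x hx => (hBd x (Ico_subset_Icc_self hx)).hasDerivWithinAt)
    (fun x hx r hr => (h.eventually_slope_energy_lt hp hσ (lt_of_lt_of_le ha hx.1) hr).frequently)
    (right_mem_Icc.2 hab)
  rw [intervalIntegral.integral_const_mul, intervalIntegral.integral_sub
    (intervalIntegrable hu ha hab) (intervalIntegrable hv ha hab)] at this
  simp only [Pi.mul_apply] at this
  linarith

theorem lintegral_abs_sub_rpow_le_expMoment (h : IsHardyPair p f F) (hp1 : 1 < p) (hp : p ≤ 2) :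
    ∫⁻ x in Ioi (0 : ℝ), ENNReal.ofReal (|F x - f x| ^ p)
      ≤ ∫⁻ x in Ioi (0 : ℝ), ENNReal.ofReal (expMoment p 0 1 * f x ^ p) := by
  have hp0 : 0 < p := by linarith
  refine lintegral_Ioi_le_of_forall_interval (E := energy p f F) (h.continuousOn_abs_sub_rpow hp0)
    (continuousOn_const.mul (h.continuousOn_rpow hp0)) (fun x => by positivity)
    (fun x => mul_nonneg (expMoment_nonneg _ _ _) (Real.rpow_nonneg (h.nonneg x) _))
    (fun a b ha hab => ?_) (h.tendsto_energy hp0 self_mem_nhdsWithin h.lim_zero h.lim_zero')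
    (h.tendsto_energy hp0 (eventually_gt_atTop 0) h.lim_top h.lim_top')
  have := h.sign_mul_energy_sub_le hp1 (σ := -1) (by linarith) ha hab
  linarith

theorem expMoment_le_lintegral_abs_sub_rpow (h : IsHardyPair p f F) (hp : 2 ≤ p) :
    ∫⁻ x in Ioi (0 : ℝ), ENNReal.ofReal (expMoment p 0 1 * f x ^ p)
      ≤ ∫⁻ x in Ioi (0 : ℝ), ENNReal.ofReal (|F x - f x| ^ p) := by
  have hp0 : 0 < p := by linarith
  refine lintegral_Ioi_le_of_forall_interval (E := fun x => -energy p f F x)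
    (continuousOn_const.mul (h.continuousOn_rpow hp0)) (h.continuousOn_abs_sub_rpow hp0)
    (fun x => mul_nonneg (expMoment_nonneg _ _ _) (Real.rpow_nonneg (h.nonneg x) _))
    (fun x => by positivity) (fun a b ha hab => ?_)
    ?_ (by simpa using (h.tendsto_energy hp0 (eventually_gt_atTop 0) h.lim_top h.lim_top').neg)
  · have := h.sign_mul_energy_sub_le (by linarith) (σ := 1) (by linarith) ha hab
    linarith
  · have := (h.tendsto_energy hp0 self_mem_nhdsWithin h.lim_zero h.lim_zero').neg
    rw [neg_zero] at this
    exact this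

end IsHardyPair

/-! ### The dual Hardy operator and the two-sided bounds -/

theorem dualHardy_antitone (g : ℝ → ℝ≥0∞) : Antitone (dualHardy g) := fun _ _ hxy =>
  lintegral_mono_set (Ioi_subset_Ioi hxy)

theorem measurable_dualHardy (g : ℝ → ℝ≥0∞) : Measurable (dualHardy g) :=
  (dualHardy_antitone g).measurable

theorem isAdmissible_dualHardy {g : ℝ → ℝ≥0∞}
    (h : ∀ x : ℝ, 0 < x → dualHardy (dualHardy g) x < ∞) : IsAdmissible (dualHardy g) :=
  ⟨(measurable_dualHardy g).aemeasurable, h⟩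

namespace IsAdmissible

variable {g : ℝ → ℝ≥0∞}

theorem aemeasurable_div (hg : IsAdmissible g) {x : ℝ} (hx : 0 < x) :
    AEMeasurable (fun t => g t / ENNReal.ofReal t) (volume.restrict (Ioi x)) :=
  (hg.1.mono_measure (Measure.restrict_mono (Ioi_subset_Ioi hx.le) le_rfl)).div
    ENNReal.measurable_ofReal.aemeasurable

theorem toReal_dualHardy (hg : IsAdmissible g) {x : ℝ} (hx : 0 < x) :
    (dualHardy g x).toReal = ∫ t in Ioi x, (g t).toReal / t := by
  rw [dualHardy, ← integral_toReal (hg.aemeasurable_div hx)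
    (ae_lt_top' (hg.aemeasurable_div hx) (hg.2 x hx).ne)]
  refine setIntegral_congr_fun measurableSet_Ioi fun t ht => ?_
  simp only [ENNReal.toReal_div]
  rw [ENNReal.toReal_ofReal (hx.trans ht).le]

theorem integrableOn (hg : IsAdmissible g) {x : ℝ} (hx : 0 < x) :
    IntegrableOn (fun t => (g t).toReal / t) (Ioi x) := by
  refine (integrable_toReal_of_lintegral_ne_top (hg.aemeasurable_div hx) (hg.2 x hx).ne).congr ?_
  refine (ae_restrict_iff' measurableSet_Ioi).2 (Eventually.of_forall fun t ht => ?_)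
  simp only [ENNReal.toReal_div]
  rw [ENNReal.toReal_ofReal (hx.trans ht).le]

theorem toReal_dualHardy_eq_sub (hg : IsAdmissible g) {a x : ℝ} (ha : 0 < a) (hx : 0 < x) :
    (dualHardy g x).toReal = (dualHardy g a).toReal - ∫ t in a..x, (g t).toReal / t := by
  rw [hg.toReal_dualHardy ha, hg.toReal_dualHardy hx,
    ← intervalIntegral.integral_interval_add_Ioi (hg.integrableOn ha) (hg.integrableOn hx)]
  ring

theorem continuousOn_toReal_dualHardy (hg : IsAdmissible g) :
    ContinuousOn (fun x => (dualHardy g x).toReal) (Ioi 0) := by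
  intro x hx
  rw [mem_Ioi] at hx
  have ha : 0 < x / 2 := by linarith
  have hmem : uIcc (x / 2) (x + 1) ∈ 𝓝 x := by
    rw [uIcc_of_le (by linarith)]
    exact Icc_mem_nhds (by linarith) (by linarith)
  have h1 : ContinuousOn (fun y => ∫ t in (x / 2)..y, (g t).toReal / t) (uIcc (x / 2) (x + 1)) := by
    refine intervalIntegral.continuousOn_primitive_interval' ?_ left_mem_uIcc
    rw [intervalIntegrable_iff_integrableOn_Ioc_of_le (by linarith)]
    exact (hg.integrableOn ha).mono_set Ioc_subset_Ioi_self
  refine ContinuousAt.continuousWithinAt ?_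
  refine ((continuousAt_const (y := (dualHardy g (x / 2)).toReal)).sub
    (h1.continuousAt hmem)).congr ?_
  filter_upwards [lt_mem_nhds hx] with y hy using (hg.toReal_dualHardy_eq_sub ha hy).symm

theorem hasDerivAt_toReal_dualHardy (hg : IsAdmissible g) {x : ℝ} (hx : 0 < x)
    (hc : ContinuousOn (fun x => (g x).toReal) (Ioi 0)) :
    HasDerivAt (fun x => (dualHardy g x).toReal) (-((g x).toReal / x)) x := by
  have hcd : ContinuousOn (fun t => (g t).toReal / t) (Ioi 0) :=
    hc.div continuousOn_id fun t ht => (mem_Ioi.1 ht).ne'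
  have h1 : HasDerivAt (fun y => ∫ t in x..y, (g t).toReal / t) ((g x).toReal / x) x :=
    intervalIntegral.integral_hasDerivAt_right (by simp)
      (hcd.stronglyMeasurableAtFilter isOpen_Ioi x hx) (hcd.continuousAt (Ioi_mem_nhds hx))
  refine (h1.const_sub (dualHardy g x).toReal).congr_of_eventuallyEq ?_
  filter_upwards [lt_mem_nhds hx] with y hy using hg.toReal_dualHardy_eq_sub hx hy

theorem antitoneOn_toReal_dualHardy (hg : IsAdmissible g) :
    AntitoneOn (fun x => (dualHardy g x).toReal) (Ioi 0) := fun x hx _ _ hxy =>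
  ENNReal.toReal_mono (hg.2 x hx).ne (dualHardy_antitone g hxy)

end IsAdmissible

/-- For decreasing `f` in `L^p`, the product `x f(x)^p` vanishes at both ends, being at most twice
the integral of `f^p` over `(x/2, x)`. -/
theorem tendsto_mul_rpow_of_antitoneOn {p : ℝ} {f : ℝ → ℝ} (hp : 0 < p) (hf : ∀ x, 0 ≤ f x)
    (ha : AntitoneOn f (Ioi 0)) (hi : IntegrableOn (fun x => f x ^ p) (Ioi 0)) :
    Tendsto (fun x => x * f x ^ p) (𝓝[>] 0) (𝓝 0) ∧
      Tendsto (fun x => x * f x ^ p) atTop (𝓝 0) := by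
  obtain ⟨S, hS⟩ : ∃ S : ℝ → ℝ, S = fun x => ∫ t in (0 : ℝ)..x, f t ^ p := ⟨_, rfl⟩
  have hII : ∀ a b : ℝ, 0 ≤ a → a ≤ b → IntervalIntegrable (fun x => f x ^ p) volume a b :=
    fun a b h0 hab => (intervalIntegrable_iff_integrableOn_Ioc_of_le hab).2
      (hi.mono_set fun x hx => lt_of_le_of_lt h0 hx.1)
  have hb : ∀ x, 0 < x → x * f x ^ p ≤ 2 * (S x - S (x / 2)) := fun x hx => by
    have e : S x - S (x / 2) = ∫ t in (x / 2)..x, f t ^ p := by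
      rw [hS]
      exact intervalIntegral.integral_interval_sub_left (hII 0 x le_rfl hx.le)
        (hII 0 (x / 2) le_rfl (by linarith))
    have h1 : ∫ t in (x / 2)..x, f x ^ p ≤ ∫ t in (x / 2)..x, f t ^ p := by
      refine intervalIntegral.integral_mono_on (by linarith) (by simp)
        (hII _ _ (by linarith) (by linarith)) fun t ht => ?_
      exact Real.rpow_le_rpow (hf x)
        (ha (mem_Ioi.2 (by linarith [ht.1])) (mem_Ioi.2 hx) ht.2) hp.le
    rw [intervalIntegral.integral_const, smul_eq_mul] at h1
    rw [e]
    linarith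
  have key : ∀ (l : Filter ℝ) (c : ℝ), (∀ᶠ x in l, 0 < x) → Tendsto S l (𝓝 c) →
      Tendsto (fun x => S (x / 2)) l (𝓝 c) → Tendsto (fun x => x * f x ^ p) l (𝓝 0) :=
    fun l c hl h1 h2 => by
      refine squeeze_zero' (hl.mono fun x hx => mul_nonneg hx.le (Real.rpow_nonneg (hf x) p))
        (hl.mono hb) ?_
      simpa using (h1.sub h2).const_mul 2
  constructor
  · have hcont : ContinuousOn S (uIcc 0 1) := by
      rw [hS]
      exact intervalIntegral.continuousOn_primitive_interval' (hII 0 1 le_rfl zero_le_one) left_mem_uIcc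
    have h0 : Tendsto S (𝓝[>] 0) (𝓝 0) := by
      have h := hcont 0 left_mem_uIcc
      rw [uIcc_of_le zero_le_one] at h
      have e : S 0 = 0 := by simp [hS]
      rw [ContinuousWithinAt, e] at h
      exact h.mono_left (nhdsWithin_le_of_mem (Icc_mem_nhdsGT (zero_lt_one' ℝ)))
    have hhalf : Tendsto (fun x : ℝ => x / 2) (𝓝[>] 0) (𝓝[>] 0) := by
      refine tendsto_nhdsWithin_iff.2 ⟨?_, ?_⟩
      · have : Tendsto (fun x : ℝ => x / 2) (𝓝 0) (𝓝 (0 / 2)) := tendsto_id.div_const 2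
        rw [zero_div] at this
        exact this.mono_left nhdsWithin_le_nhds
      · exact eventually_nhdsWithin_of_forall fun x hx => half_pos (mem_Ioi.1 hx)
    exact key _ 0 (eventually_nhdsWithin_of_forall fun x hx => hx) h0 (h0.comp hhalf)
  · have h0 : Tendsto S atTop (𝓝 (∫ t in Ioi 0, f t ^ p)) := by
      rw [hS]
      exact intervalIntegral_tendsto_integral_Ioi 0 hi tendsto_id
    exact key _ _ (eventually_gt_atTop 0) h0 (h0.comp (tendsto_id.atTop_div_const two_pos))

/-- Powers `t^(-1/p)` are eigenfunctions of `H^*` with eigenvalue `p`. -/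
theorem dualHardy_le_of_le_rpow {φ : ℝ → ℝ≥0∞} {p ε x : ℝ} (hp : 0 < p) (hε : 0 ≤ ε)
    (hx : 0 < x) (h : ∀ t, x < t → φ t ≤ ENNReal.ofReal (ε * t ^ (-(1 / p)))) :
    dualHardy φ x ≤ ENNReal.ofReal (p * ε * x ^ (-(1 / p))) := by
  have hlt : -(1 / p) - 1 < -1 := by
    have : 0 < 1 / p := by positivity
    linarith
  have hi := (integrableOn_Ioi_rpow_of_lt hlt hx).const_mul ε
  have hval : ∫ t in Ioi x, ε * t ^ (-(1 / p) - 1) = p * ε * x ^ (-(1 / p)) := by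
    rw [integral_const_mul, integral_Ioi_rpow_of_lt hlt hx, sub_add_cancel]
    field_simp
  rw [← hval, ofReal_integral_eq_lintegral_ofReal hi
    ((ae_restrict_iff' measurableSet_Ioi).2 (Eventually.of_forall fun t ht =>
      mul_nonneg hε (Real.rpow_nonneg (hx.trans ht).le _)))]
  refine setLIntegral_mono' measurableSet_Ioi fun t ht => ?_
  have ht0 : 0 < t := hx.trans ht
  refine ENNReal.div_le_of_le_mul ?_
  rw [← ENNReal.ofReal_mul (mul_nonneg hε (Real.rpow_nonneg ht0.le _)), mul_assoc,
    Real.rpow_sub_one ht0.ne', div_mul_cancel₀ _ ht0.ne']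
  exact h t ht

theorem le_mul_rpow_neg_of_mul_rpow_le {p y t ε : ℝ} (hp : 0 < p) (hy : 0 ≤ y) (ht : 0 < t)
    (hε : 0 ≤ ε) (h : t * y ^ p ≤ ε ^ p) : y ≤ ε * t ^ (-(1 / p)) := by
  have h1 : y ^ p ≤ (ε * t ^ (-(1 / p))) ^ p := by
    rw [Real.mul_rpow hε (Real.rpow_nonneg ht.le _), ← Real.rpow_mul ht.le,
      show -(1 / p) * p = -1 by field_simp, Real.rpow_neg_one, ← div_eq_mul_inv,
      le_div_iff₀' ht]
    exact h
  exact (Real.rpow_le_rpow_iff hy (mul_nonneg hε (Real.rpow_nonneg ht.le _)) hp).1 h1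

theorem mul_rpow_eq_rpow_mul {p y t : ℝ} (hp : 0 < p) (hy : 0 ≤ y) (ht : 0 < t) :
    t * y ^ p = (t ^ (1 / p) * y) ^ p := by
  rw [Real.mul_rpow (Real.rpow_nonneg ht.le _) hy, ← Real.rpow_mul ht.le,
    one_div_mul_cancel hp.ne', Real.rpow_one]

theorem IsAdmissible.dualHardy_sq_lt_top {g : ℝ → ℝ≥0∞} (hg : IsAdmissible g) {p : ℝ}
    (hp : 0 < p)
    (hi : IntegrableOn (fun x => (dualHardy g x).toReal ^ p) (Ioi 0)) {x : ℝ} (hx : 0 < x) :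
    dualHardy (dualHardy g) x < ∞ := by
  set I := ∫ t in Ioi 0, (dualHardy g t).toReal ^ p
  have hI : 0 ≤ I := setIntegral_nonneg measurableSet_Ioi fun t _ => by positivity
  have hb : ∀ t, 0 < t → t * (dualHardy g t).toReal ^ p ≤ I := fun t ht => by
    have h1 : ∫ s in Ioc 0 t, (dualHardy g t).toReal ^ p ≤ I := by
      refine le_trans (setIntegral_mono_on (by simp) (hi.mono_set Ioc_subset_Ioi_self)
        measurableSet_Ioc fun s hs => ?_) (setIntegral_mono_set hi
          (Eventually.of_forall fun s => by positivity)
          (LE.le.eventuallyLE Ioc_subset_Ioi_self))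
      exact Real.rpow_le_rpow ENNReal.toReal_nonneg
        (hg.antitoneOn_toReal_dualHardy hs.1 ht hs.2) hp.le
    simpa [ht.le] using h1
  have hIp : I = (I ^ (1 / p)) ^ p := by
    rw [← Real.rpow_mul hI, one_div_mul_cancel hp.ne', Real.rpow_one]
  refine lt_of_le_of_lt (dualHardy_le_of_le_rpow hp (Real.rpow_nonneg hI (1 / p)) hx
    fun t ht => ?_) ENNReal.ofReal_lt_top
  have ht0 := hx.trans ht
  rw [← ENNReal.ofReal_toReal (hg.2 t ht0).ne]
  exact ENNReal.ofReal_le_ofReal (le_mul_rpow_neg_of_mul_rpow_le hp ENNReal.toReal_nonneg ht0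
    (Real.rpow_nonneg hI _) (hIp ▸ hb t ht0))

theorem IsAdmissible.isHardyPair {g : ℝ → ℝ≥0∞} (hg : IsAdmissible g) {p : ℝ} (hp : 0 < p)
    (hi : IntegrableOn (fun x => (dualHardy g x).toReal ^ p) (Ioi 0)) :
    IsHardyPair p (fun x => (dualHardy g x).toReal)
      (fun x => (dualHardy (dualHardy g) x).toReal) := by
  set f : ℝ → ℝ := fun x => (dualHardy g x).toReal with hf
  set F : ℝ → ℝ := fun x => (dualHardy (dualHardy g) x).toReal with hF
  have hadm : IsAdmissible (dualHardy g) :=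
    isAdmissible_dualHardy fun x hx => hg.dualHardy_sq_lt_top hp hi hx
  have hf0 : ∀ x, 0 ≤ f x := fun x => ENNReal.toReal_nonneg
  have hF0 : ∀ x, 0 ≤ F x := fun x => ENNReal.toReal_nonneg
  have hanti : AntitoneOn f (Ioi 0) := hg.antitoneOn_toReal_dualHardy
  have hcont : ContinuousOn f (Ioi 0) := hg.continuousOn_toReal_dualHardy
  have hderiv : ∀ x, 0 < x → HasDerivAt F (-(f x / x)) x :=
    fun x hx => hadm.hasDerivAt_toReal_dualHardy hx hcont
  obtain ⟨hl0, hlt⟩ := tendsto_mul_rpow_of_antitoneOn hp hf0 hanti hi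
  have hpinv : 0 < 1 / p := by positivity
  -- it suffices to bound `x^(1/p) F(x)`
  have hred : ∀ l : Filter ℝ, (∀ᶠ x in l, 0 < x) →
      (∀ ε : ℝ, 0 < ε → ∀ᶠ x in l, x ^ (1 / p) * F x ≤ ε) →
      Tendsto (fun x => x * F x ^ p) l (𝓝 0) := fun l hl h => by
    have h1 : Tendsto (fun x => x ^ (1 / p) * F x) l (𝓝 0) := by
      rw [Metric.tendsto_nhds]
      intro ε hε
      filter_upwards [hl, h (ε / 2) (by linarith)] with x hx hx2
      rw [Real.dist_eq, sub_zero, abs_of_nonneg (mul_nonneg (Real.rpow_nonneg hx.le _) (hF0 x))]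
      linarith
    have h2 := h1.rpow_const (p := p) (Or.inr hp.le)
    rw [Real.zero_rpow hp.ne'] at h2
    exact h2.congr' (hl.mono fun x hx => (mul_rpow_eq_rpow_mul hp (hF0 x) hx).symm)
  refine ⟨hf0, hF0, hanti, hcont, hderiv, fun x hx h0 => ?_, hl0, hlt, ?_, ?_⟩
  · have hφ : dualHardy g x = 0 := by
      rcases (ENNReal.toReal_eq_zero_iff _).1 h0 with h | h
      · exact h
      · exact absurd h (hg.2 x hx).ne
    have : dualHardy (dualHardy g) x = 0 := by
      rw [dualHardy, setLIntegral_congr_fun (g := fun _ => 0) measurableSet_Ioi fun t ht => ?_]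
      · simp
      · have : dualHardy g t = 0 := le_antisymm (hφ ▸ dualHardy_antitone g (mem_Ioi.1 ht).le) bot_le
        simp [this]
    simp [hF, this]
  · refine hred _ self_mem_nhdsWithin fun ε hε => ?_
    set η := ε / (2 * p) with hη
    have hη0 : 0 < η := by positivity
    have h1 : ∀ᶠ x in 𝓝[>] (0 : ℝ), x * f x ^ p < η ^ p :=
      hl0.eventually (gt_mem_nhds (Real.rpow_pos_of_pos hη0 p))
    obtain ⟨δ, hδ, hδ'⟩ := mem_nhdsGT_iff_exists_Ioc_subset.1 h1
    have hδ0 : 0 < δ := hδ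
    -- on `(0, δ]` the function `F - p η x^(-1/p)` is increasing
    have hmono : MonotoneOn (fun x => F x - p * η * x ^ (-(1 / p))) (Ioc 0 δ) := by
      have hd : ∀ x ∈ Ioc 0 δ, HasDerivAt (fun x => F x - p * η * x ^ (-(1 / p)))
          (-(f x / x) - p * η * (1 * -(1 / p) * x ^ (-(1 / p) - 1))) x := fun x hx =>
        (hderiv x hx.1).sub
          (((hasDerivAt_id x).rpow_const (Or.inl hx.1.ne')).const_mul (p * η))
      refine monotoneOn_of_deriv_nonneg (convex_Ioc 0 δ)
        (fun x hx => (hd x hx).continuousAt.continuousWithinAt)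
        (fun x hx => (hd x (interior_subset hx)).differentiableAt.differentiableWithinAt)
        fun x hx => ?_
      have hx' := interior_subset hx
      rw [(hd x hx').deriv, Real.rpow_sub_one hx'.1.ne']
      have := le_mul_rpow_neg_of_mul_rpow_le hp (hf0 x) hx'.1 hη0.le (hδ' hx').le
      have e : -(f x / x) - p * η * (1 * -(1 / p) * (x ^ (-(1 / p)) / x))
          = (η * x ^ (-(1 / p)) - f x) / x := by field_simp; ring
      rw [e]
      exact div_nonneg (by linarith) hx'.1.le
    have hlim : Tendsto (fun x : ℝ => x ^ (1 / p) * F δ) (𝓝[>] 0) (𝓝 0) := by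
      have : Tendsto (fun x : ℝ => x ^ (1 / p)) (𝓝 0) (𝓝 (0 ^ (1 / p))) :=
        (Real.continuousAt_rpow_const 0 (1 / p) (Or.inr hpinv.le)).tendsto
      rw [Real.zero_rpow hpinv.ne'] at this
      simpa using (this.mono_left nhdsWithin_le_nhds).mul_const (F δ)
    filter_upwards [hlim.eventually (gt_mem_nhds (half_pos hε)), Ioc_mem_nhdsGT hδ0,
      self_mem_nhdsWithin] with x h2 hx hx0
    rw [mem_Ioi] at hx0
    have h3 := hmono hx (right_mem_Ioc.2 hδ0) hx.2
    simp only at h3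
    have h4 : 0 ≤ p * η * δ ^ (-(1 / p)) := by positivity
    have h5 : F x ≤ F δ + p * η * x ^ (-(1 / p)) := by linarith
    have h6 := mul_le_mul_of_nonneg_left h5 (Real.rpow_nonneg hx0.le (1 / p))
    have h7 : x ^ (1 / p) * x ^ (-(1 / p)) = 1 := by
      rw [← Real.rpow_add hx0, add_neg_cancel, Real.rpow_zero]
    have h8 : p * η = ε / 2 := by rw [hη]; field_simp
    calc x ^ (1 / p) * F x ≤ x ^ (1 / p) * (F δ + p * η * x ^ (-(1 / p))) := h6
      _ = x ^ (1 / p) * F δ + p * η * (x ^ (1 / p) * x ^ (-(1 / p))) := by ring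
      _ ≤ ε := by rw [h7, h8]; linarith
  · refine hred _ (eventually_gt_atTop 0) fun ε hε => ?_
    set η := ε / p with hη
    have hη0 : 0 < η := by positivity
    obtain ⟨X, hX⟩ := eventually_atTop.1
      (hlt.eventually (gt_mem_nhds (Real.rpow_pos_of_pos hη0 p)))
    filter_upwards [eventually_ge_atTop X, eventually_gt_atTop 0] with x hx hx0
    have h1 : dualHardy (dualHardy g) x ≤ ENNReal.ofReal (p * η * x ^ (-(1 / p))) :=
      dualHardy_le_of_le_rpow hp hη0.le hx0 fun t ht => by
        have ht0 := hx0.trans ht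
        rw [← ENNReal.ofReal_toReal (hg.2 t ht0).ne]
        exact ENNReal.ofReal_le_ofReal (le_mul_rpow_neg_of_mul_rpow_le hp ENNReal.toReal_nonneg
          ht0 hη0.le (hX t (hx.trans ht.le)).le)
    have h2 : F x ≤ p * η * x ^ (-(1 / p)) :=
      ENNReal.toReal_le_of_le_ofReal (by positivity) h1
    have h6 := mul_le_mul_of_nonneg_left h2 (Real.rpow_nonneg hx0.le (1 / p))
    have h7 : x ^ (1 / p) * x ^ (-(1 / p)) = 1 := by
      rw [← Real.rpow_add hx0, add_neg_cancel, Real.rpow_zero]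
    have h8 : p * η = ε := by rw [hη]; field_simp
    calc x ^ (1 / p) * F x ≤ x ^ (1 / p) * (p * η * x ^ (-(1 / p))) := h6
      _ = p * η * (x ^ (1 / p) * x ^ (-(1 / p))) := by ring
      _ ≤ ε := by rw [h7, h8, mul_one]

theorem halfLineNorm_eq_eLpNorm {p : ℝ} {u : ℝ → EReal} {r : ℝ → ℝ}
    (h : ∀ x, 0 < x → u x = (r x : EReal)) :
    halfLineNorm p u = eLpNorm r (ENNReal.ofReal p) (volume.restrict (Ioi 0)) := by
  refine eLpNorm_congr_enorm_ae ((ae_restrict_iff' measurableSet_Ioi).2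
    (Eventually.of_forall fun x hx => ?_))
  rw [h x hx, EReal.abs_def, Real.enorm_eq_ofReal_abs, enorm_eq_self]

theorem coe_eq_coe_toReal {a : ℝ≥0∞} (ha : a ≠ ∞) : (a : EReal) = ((a.toReal : ℝ) : EReal) := by
  rw [← EReal.toReal_coe_ennreal, EReal.coe_toReal (by simpa using ha) (by simp)]

theorem normDualHardy_eq {g : ℝ → ℝ≥0∞} (hg : IsAdmissible g) (p : ℝ) :
    normDualHardy p g = eLpNorm (fun x => (dualHardy g x).toReal) (ENNReal.ofReal p)
      (volume.restrict (Ioi 0)) :=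
  halfLineNorm_eq_eLpNorm fun x hx => coe_eq_coe_toReal (hg.2 x hx).ne

theorem normDualHardySqSub_eq {g : ℝ → ℝ≥0∞} (hg : IsAdmissible g)
    (h2 : ∀ x, 0 < x → dualHardy (dualHardy g) x < ∞) (p : ℝ) :
    normDualHardySqSub p g = eLpNorm
      (fun x => (dualHardy (dualHardy g) x).toReal - (dualHardy g x).toReal) (ENNReal.ofReal p)
      (volume.restrict (Ioi 0)) :=
  halfLineNorm_eq_eLpNorm fun x hx => by
    rw [dualHardySqSub, coe_eq_coe_toReal (hg.2 x hx).ne, coe_eq_coe_toReal (h2 x hx).ne,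
      EReal.coe_sub]

theorem eLpNorm_Ioi_eq {p : ℝ} (hp : 0 < p) (r : ℝ → ℝ) :
    eLpNorm r (ENNReal.ofReal p) (volume.restrict (Ioi 0))
      = (∫⁻ x in Ioi (0 : ℝ), ENNReal.ofReal (|r x| ^ p)) ^ (1 / p) := by
  rw [eLpNorm_eq_lintegral_rpow_enorm_toReal (by simpa using hp) ENNReal.ofReal_ne_top,
    ENNReal.toReal_ofReal hp.le]
  congr 1
  refine lintegral_congr fun x => ?_
  rw [Real.enorm_eq_ofReal_abs, ENNReal.ofReal_rpow_of_nonneg (abs_nonneg _) hp.le]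

theorem IsAdmissible.integrableOn_rpow {g : ℝ → ℝ≥0∞} (hg : IsAdmissible g) {p : ℝ} (hp : 0 < p)
    (hfin : normDualHardy p g < ∞) :
    IntegrableOn (fun x => (dualHardy g x).toReal ^ p) (Ioi 0) := by
  have hm : AEStronglyMeasurable (fun x => (dualHardy g x).toReal) (volume.restrict (Ioi 0)) :=
    (measurable_dualHardy g).ennreal_toReal.aestronglyMeasurable
  rw [normDualHardy_eq hg] at hfin
  have h : MemLp (fun x => (dualHardy g x).toReal) (ENNReal.ofReal p)
    (volume.restrict (Ioi 0)) := ⟨hm, hfin⟩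
  have := h.integrable_norm_rpow (by simpa using hp) ENNReal.ofReal_ne_top
  rw [ENNReal.toReal_ofReal hp.le] at this
  refine this.congr (Eventually.of_forall fun x => ?_)
  simp

theorem hardyConst_eq {p : ℝ} (hp : 0 < p) :
    hardyConst p = ENNReal.ofReal (expMoment p 0 1) := by
  have himg : (fun s : ℝ => Real.exp (-s)) '' Ioi 0 = Ioo 0 1 := by
    ext y
    constructor
    · rintro ⟨s, hs, rfl⟩
      exact ⟨Real.exp_pos _, by simpa using hs⟩
    · rintro ⟨h0, h1⟩
      exact ⟨-Real.log y, by simpa using Real.log_neg h0 h1, by simp [Real.exp_log h0]⟩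
  have hd : ∀ s ∈ Ioi (0 : ℝ), HasDerivWithinAt (fun s : ℝ => Real.exp (-s)) (-Real.exp (-s))
      (Ioi 0) s := fun s _ => by
    have := (hasDerivAt_neg s).exp.hasDerivWithinAt (s := Ioi 0)
    simpa using this
  have hinj : InjOn (fun s : ℝ => Real.exp (-s)) (Ioi 0) := fun a _ b _ hab => by
    simpa using hab
  rw [hardyConst, ← himg, lintegral_image_eq_lintegral_abs_deriv_mul measurableSet_Ioi hd hinj,
    expMoment, ofReal_integral_eq_lintegral_ofReal (integrableOn_exp_neg_mul_abs_rpow hp 0 1)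
      (Eventually.of_forall fun s => by positivity)]
  refine lintegral_congr fun s => ?_
  rw [abs_neg, abs_of_pos (Real.exp_pos _), Real.log_exp,
    ← ENNReal.ofReal_mul (Real.exp_pos _).le, zero_add, one_mul, abs_sub_comm,
    ← sub_eq_add_neg]

theorem const_mul_eLpNorm {p c : ℝ} (hp : 0 < p) (hc : 0 ≤ c) {r : ℝ → ℝ} (hr : ∀ x, 0 ≤ r x) :
    (∫⁻ x in Ioi (0 : ℝ), ENNReal.ofReal (c * r x ^ p)) ^ (1 / p)
      = ENNReal.ofReal c ^ (1 / p) * eLpNorm r (ENNReal.ofReal p) (volume.restrict (Ioi 0)) := by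
  rw [eLpNorm_Ioi_eq hp, ← ENNReal.mul_rpow_of_nonneg _ _ (by positivity),
    ← lintegral_const_mul' _ _ ENNReal.ofReal_ne_top]
  congr 1
  refine lintegral_congr fun x => ?_
  rw [abs_of_nonneg (hr x), ENNReal.ofReal_mul hc]

theorem ofReal_rpow_rpow_one_div {p c : ℝ} (hp : 0 < p) (hc : 0 ≤ c) :
    ENNReal.ofReal (c ^ p) ^ (1 / p) = ENNReal.ofReal c := by
  rw [← ENNReal.ofReal_rpow_of_nonneg hc hp.le, ← ENNReal.rpow_mul, mul_one_div_cancel hp.ne',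
    ENNReal.rpow_one]

section Bounds

variable {p : ℝ} {g : ℝ → ℝ≥0∞}

theorem sub_one_mul_normDualHardy_le (hp1 : 1 < p) (hp : p ≤ 2) (hg : IsAdmissible g)
    (hfin : normDualHardy p g < ∞) :
    ENNReal.ofReal (p - 1) * normDualHardy p g ≤ normDualHardySqSub p g := by
  have hp0 : 0 < p := by linarith
  have hi := hg.integrableOn_rpow hp0 hfin
  rw [normDualHardySqSub_eq hg (fun x hx => hg.dualHardy_sq_lt_top hp0 hi hx),
    normDualHardy_eq hg, ← ofReal_rpow_rpow_one_div hp0 (by linarith : 0 ≤ p - 1),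
    ← const_mul_eLpNorm hp0 (Real.rpow_nonneg (by linarith) _) fun x => ENNReal.toReal_nonneg,
    eLpNorm_Ioi_eq hp0]
  exact ENNReal.rpow_le_rpow ((hg.isHardyPair hp0 hi).le_lintegral_abs_sub_rpow hp1 hp)
    (by positivity)

theorem normDualHardySqSub_le_hardyConst (hp1 : 1 < p) (hp : p ≤ 2) (hg : IsAdmissible g) :
    normDualHardySqSub p g ≤ hardyConst p ^ (1 / p) * normDualHardy p g := by
  have hp0 : 0 < p := by linarith
  rw [hardyConst_eq hp0]
  rcases (le_top : normDualHardy p g ≤ ∞).eq_or_lt with hfin | hfin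
  · rw [hfin, ENNReal.mul_top]
    · exact le_top
    · simp [ENNReal.rpow_eq_zero_iff, expMoment_pos hp0, hp0]
  have hi := hg.integrableOn_rpow hp0 hfin
  rw [normDualHardySqSub_eq hg (fun x hx => hg.dualHardy_sq_lt_top hp0 hi hx),
    normDualHardy_eq hg,
    ← const_mul_eLpNorm hp0 (expMoment_nonneg _ _ _) fun x => ENNReal.toReal_nonneg,
    eLpNorm_Ioi_eq hp0]
  exact ENNReal.rpow_le_rpow ((hg.isHardyPair hp0 hi).lintegral_abs_sub_rpow_le_expMoment hp1 hp)
    (by positivity)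

theorem hardyConst_mul_normDualHardy_le (hp : 2 ≤ p) (hg : IsAdmissible g)
    (hfin : normDualHardy p g < ∞) :
    hardyConst p ^ (1 / p) * normDualHardy p g ≤ normDualHardySqSub p g := by
  have hp0 : 0 < p := by linarith
  have hi := hg.integrableOn_rpow hp0 hfin
  rw [hardyConst_eq hp0, normDualHardySqSub_eq hg (fun x hx => hg.dualHardy_sq_lt_top hp0 hi hx),
    normDualHardy_eq hg,
    ← const_mul_eLpNorm hp0 (expMoment_nonneg _ _ _) fun x => ENNReal.toReal_nonneg,
    eLpNorm_Ioi_eq hp0]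
  exact ENNReal.rpow_le_rpow ((hg.isHardyPair hp0 hi).expMoment_le_lintegral_abs_sub_rpow hp)
    (by positivity)

theorem normDualHardySqSub_le_sub_one (hp : 2 ≤ p) (hg : IsAdmissible g) :
    normDualHardySqSub p g ≤ ENNReal.ofReal (p - 1) * normDualHardy p g := by
  have hp0 : 0 < p := by linarith
  rcases (le_top : normDualHardy p g ≤ ∞).eq_or_lt with hfin | hfin
  · rw [hfin, ENNReal.mul_top]
    · exact le_top
    · simp only [ne_eq, ENNReal.ofReal_eq_zero, not_le]; linarith
  have hi := hg.integrableOn_rpow hp0 hfin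
  rw [normDualHardySqSub_eq hg (fun x hx => hg.dualHardy_sq_lt_top hp0 hi hx),
    normDualHardy_eq hg, ← ofReal_rpow_rpow_one_div hp0 (by linarith : 0 ≤ p - 1),
    ← const_mul_eLpNorm hp0 (Real.rpow_nonneg (by linarith) _) fun x => ENNReal.toReal_nonneg,
    eLpNorm_Ioi_eq hp0]
  exact ENNReal.rpow_le_rpow ((hg.isHardyPair hp0 hi).lintegral_abs_sub_rpow_le hp)
    (by positivity)

end Bounds

/-! ### Optimality of the constant from the exponential law -/

theorem dualHardy_congr {g₁ g₂ : ℝ → ℝ≥0∞} {x : ℝ} (h : ∀ t, x < t → g₁ t = g₂ t) :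
    dualHardy g₁ x = dualHardy g₂ x :=
  setLIntegral_congr_fun measurableSet_Ioi fun t ht => by simp only [h t ht]

theorem dualHardy_eq_zero {g : ℝ → ℝ≥0∞} {x : ℝ} (h : ∀ t, x < t → g t = 0) :
    dualHardy g x = 0 := by
  rw [dualHardy_congr (g₂ := fun _ => 0) h]
  simp [dualHardy]

theorem dualHardy_eq_add {g : ℝ → ℝ≥0∞} {x y : ℝ} (hxy : x ≤ y) :
    dualHardy g x = (∫⁻ t in Ioc x y, g t / ENNReal.ofReal t) + dualHardy g y := by
  rw [dualHardy, dualHardy, ← Ioc_union_Ioi_eq_Ioi hxy,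
    lintegral_union measurableSet_Ioi (Ioc_disjoint_Ioi le_rfl)]

theorem setLIntegral_Ioc_div_eq {w W : ℝ → ℝ} {x b : ℝ} (hx : 0 < x) (hxb : x ≤ b)
    (hw : ContinuousOn w (Icc x b)) (hw0 : ∀ t ∈ Icc x b, 0 ≤ w t)
    (hW : ∀ t ∈ Icc x b, HasDerivAt W (-(w t / t)) t) :
    ∫⁻ t in Ioc x b, ENNReal.ofReal (w t) / ENNReal.ofReal t = ENNReal.ofReal (W x - W b) := by
  have hc : ContinuousOn (fun t => w t / t) (Icc x b) :=
    hw.div continuousOn_id fun t ht => (hx.trans_le ht.1).ne'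
  have hi : IntervalIntegrable (fun t => w t / t) volume x b := hc.intervalIntegrable_of_Icc hxb
  have h1 : ∫ t in x..b, w t / t = W x - W b := by
    have := intervalIntegral.integral_eq_sub_of_hasDerivAt (f := fun t => -W t)
      (f' := fun t => w t / t) (a := x) (b := b)
      (fun t ht => by
        rw [uIcc_of_le hxb] at ht
        exact (hW t ht).neg.congr_deriv (neg_neg _)) hi
    rw [this]; ring
  rw [← h1, intervalIntegral.integral_of_le hxb, ofReal_integral_eq_lintegral_ofReal
    ((intervalIntegrable_iff_integrableOn_Ioc_of_le hxb).1 hi)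
    ((ae_restrict_iff' measurableSet_Ioc).2 (Eventually.of_forall fun t ht =>
      div_nonneg (hw0 t (Ioc_subset_Icc_self ht)) (hx.trans ht.1).le))]
  refine setLIntegral_congr_fun measurableSet_Ioc fun t ht => ?_
  exact (ENNReal.ofReal_div_of_pos (hx.trans ht.1)).symm

/-- `(H^* - I)` applied to the indicator function of `(0,1]`, restricted to that interval. -/
noncomputable def logProfile : ℝ → ℝ := (Ioc (0 : ℝ) 1).indicator fun x => -Real.log x - 1

theorem measurable_logProfile : Measurable logProfile :=
  (Real.measurable_log.neg.sub_const 1).indicator measurableSet_Ioc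

theorem eLpNorm_logProfile {p : ℝ} (hp : 0 < p) :
    eLpNorm logProfile (ENNReal.ofReal p) (volume.restrict (Ioi 0)) = hardyConst p ^ (1 / p) := by
  rw [eLpNorm_Ioi_eq hp, hardyConst]
  congr 1
  have h1 : ∀ x, ENNReal.ofReal (|logProfile x| ^ p)
      = (Ioc (0 : ℝ) 1).indicator (fun x => ENNReal.ofReal (|1 + Real.log x| ^ p)) x := fun x => by
    by_cases hx : x ∈ Ioc (0 : ℝ) 1
    · rw [logProfile, indicator_of_mem hx, indicator_of_mem hx, ← abs_neg]
      congr 3; ring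
    · rw [logProfile, indicator_of_notMem hx, indicator_of_notMem hx, abs_zero,
        Real.zero_rpow hp.ne', ENNReal.ofReal_zero]
  simp_rw [h1]
  rw [lintegral_indicator measurableSet_Ioc, Measure.restrict_restrict measurableSet_Ioc,
    inter_eq_self_of_subset_left Ioc_subset_Ioi_self]
  exact setLIntegral_congr Ioo_ae_eq_Ioc.symm

theorem hardyConst_rpow_ne_top {p : ℝ} (hp : 0 < p) : hardyConst p ^ (1 / p) ≠ ∞ := by
  rw [hardyConst_eq hp]
  exact ENNReal.rpow_ne_top_of_nonneg (by positivity) ENNReal.ofReal_ne_top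

theorem eLpNorm_indicator_const_Ioi {p c : ℝ} (hp : 0 < p) {s : Set ℝ} (hs : MeasurableSet s)
    (hs0 : s ⊆ Ioi 0) :
    eLpNorm (s.indicator fun _ => c) (ENNReal.ofReal p) (volume.restrict (Ioi 0))
      = ENNReal.ofReal |c| * volume s ^ (1 / p) := by
  rw [eLpNorm_indicator_const hs (by simpa using hp) ENNReal.ofReal_ne_top,
    ENNReal.toReal_ofReal hp.le, Measure.restrict_apply hs, inter_eq_self_of_subset_left hs0,
    Real.enorm_eq_ofReal_abs]

section Bump

variable {δ : ℝ}

/-- An approximate point mass at `1`, of unit mass for the measure `dt/t`. -/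
noncomputable def bump (δ : ℝ) : ℝ → ℝ≥0∞ :=
  (Ioc (1 : ℝ) (1 + δ)).indicator fun t => ENNReal.ofReal (t / δ)

theorem measurable_bump (δ : ℝ) : Measurable (bump δ) :=
  ((measurable_id.div_const δ).ennreal_ofReal).indicator measurableSet_Ioc

theorem dualHardy_bump_of_le (hδ : 0 < δ) {x : ℝ} (hx : x ≤ 1) : dualHardy (bump δ) x = 1 := by
  have h1 : ∀ t, bump δ t / ENNReal.ofReal t
      = (Ioc (1 : ℝ) (1 + δ)).indicator (fun _ => ENNReal.ofReal (1 / δ)) t := fun t => by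
    by_cases ht : t ∈ Ioc (1 : ℝ) (1 + δ)
    · have ht0 : 0 < t := by linarith [ht.1]
      rw [bump, indicator_of_mem ht, indicator_of_mem ht, ← ENNReal.ofReal_div_of_pos ht0]
      congr 1; field_simp
    · simp [bump, indicator_of_notMem ht]
  have hsub : Ioc (1 : ℝ) (1 + δ) ⊆ Ioi x := fun t ht => lt_of_le_of_lt hx ht.1
  rw [dualHardy]
  simp_rw [h1]
  rw [lintegral_indicator measurableSet_Ioc, Measure.restrict_restrict measurableSet_Ioc,
    inter_eq_self_of_subset_left hsub, setLIntegral_const, Real.volume_Ioc,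
    ← ENNReal.ofReal_mul (by positivity)]
  rw [add_sub_cancel_left, one_div_mul_cancel hδ.ne', ENNReal.ofReal_one]

theorem dualHardy_bump_of_ge {x : ℝ} (hx : 1 + δ ≤ x) : dualHardy (bump δ) x = 0 :=
  dualHardy_eq_zero fun t ht => by
    rw [bump, indicator_of_notMem]
    exact fun h => absurd h.2 (by linarith)

theorem dualHardy_bump_le_one (hδ : 0 < δ) (x : ℝ) : dualHardy (bump δ) x ≤ 1 := by
  rcases le_total x 1 with h | h
  · exact (dualHardy_bump_of_le hδ h).le
  · exact (dualHardy_antitone _ h).trans (dualHardy_bump_of_le hδ le_rfl).le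

theorem isAdmissible_bump (hδ : 0 < δ) : IsAdmissible (bump δ) :=
  ⟨(measurable_bump δ).aemeasurable, fun x _ =>
    (dualHardy_bump_le_one hδ x).trans_lt ENNReal.one_lt_top⟩

theorem dualHardy_sq_bump_one_le (hδ : 0 < δ) :
    dualHardy (dualHardy (bump δ)) 1 ≤ ENNReal.ofReal δ := by
  calc dualHardy (dualHardy (bump δ)) 1
      ≤ ∫⁻ t in Ioi (1 : ℝ), (Ioc (1 : ℝ) (1 + δ)).indicator (fun _ => 1) t := by
        refine setLIntegral_mono' measurableSet_Ioi fun t ht => ?_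
        by_cases h : t ∈ Ioc (1 : ℝ) (1 + δ)
        · rw [indicator_of_mem h]
          have h1 : 1 ≤ ENNReal.ofReal t := by
            rw [← ENNReal.ofReal_one]; exact ENNReal.ofReal_le_ofReal h.1.le
          exact ENNReal.div_le_of_le_mul (by
            rw [one_mul]; exact (dualHardy_bump_le_one hδ t).trans h1)
        · have : 1 + δ ≤ t := by
            by_contra hc
            exact h ⟨ht, by linarith⟩
          simp [dualHardy_bump_of_ge this]
    _ = ENNReal.ofReal δ := by
        rw [lintegral_indicator measurableSet_Ioc, Measure.restrict_restrict measurableSet_Ioc,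
          inter_eq_self_of_subset_left Ioc_subset_Ioi_self, setLIntegral_const, Real.volume_Ioc]
        simp

theorem dualHardy_sq_bump_of_ge {x : ℝ} (hx : 1 + δ ≤ x) :
    dualHardy (dualHardy (bump δ)) x = 0 :=
  dualHardy_eq_zero fun _ ht => dualHardy_bump_of_ge (hx.trans ht.le)

theorem dualHardy_sq_bump_of_le (hδ : 0 < δ) {x : ℝ} (hx0 : 0 < x) (hx : x ≤ 1) :
    dualHardy (dualHardy (bump δ)) x
      = ENNReal.ofReal (-Real.log x) + dualHardy (dualHardy (bump δ)) 1 := by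
  rw [dualHardy_eq_add hx]
  congr 1
  have h := setLIntegral_Ioc_div_eq (w := fun _ => 1) (W := fun t => -Real.log t) hx0 hx
    continuousOn_const (fun _ _ => zero_le_one) fun t ht => by
      exact (Real.hasDerivAt_log (hx0.trans_le ht.1).ne').neg.congr_deriv (by rw [one_div])
  rw [Real.log_one, neg_zero, sub_zero] at h
  rw [← h]
  refine setLIntegral_congr_fun measurableSet_Ioc fun t ht => ?_
  simp only [dualHardy_bump_of_le hδ ht.2, ENNReal.ofReal_one]

theorem dualHardy_sq_bump_lt_top (hδ : 0 < δ) {x : ℝ} (hx : 0 < x) :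
    dualHardy (dualHardy (bump δ)) x < ∞ := by
  have h1 := (dualHardy_sq_bump_one_le hδ).trans_lt ENNReal.ofReal_lt_top
  rcases le_total x 1 with h | h
  · rw [dualHardy_sq_bump_of_le hδ hx h]
    exact ENNReal.add_lt_top.2 ⟨ENNReal.ofReal_lt_top, h1⟩
  · exact (dualHardy_antitone _ h).trans_lt h1

theorem one_le_normDualHardy_bump {p : ℝ} (hp : 0 < p) (hδ : 0 < δ) :
    1 ≤ normDualHardy p (bump δ) := by
  rw [normDualHardy_eq (isAdmissible_bump hδ)]
  have h := eLpNorm_indicator_const_Ioi (c := 1) hp (measurableSet_Ioc (a := (0 : ℝ)) (b := 1))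
    Ioc_subset_Ioi_self
  rw [abs_one, ENNReal.ofReal_one, Real.volume_Ioc, sub_zero, ENNReal.ofReal_one,
    ENNReal.one_rpow, one_mul] at h
  rw [← h]
  refine eLpNorm_mono_real fun x => ?_
  by_cases hx : x ∈ Ioc (0 : ℝ) 1
  · rw [indicator_of_mem hx, dualHardy_bump_of_le hδ hx.2]; simp
  · rw [indicator_of_notMem hx]; simp

theorem normDualHardy_bump_le {p : ℝ} (hp : 0 < p) (hδ : 0 < δ) :
    normDualHardy p (bump δ) ≤ ENNReal.ofReal (1 + δ) ^ (1 / p) := by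
  rw [normDualHardy_eq (isAdmissible_bump hδ)]
  have h := eLpNorm_indicator_const_Ioi (c := 1) hp
    (measurableSet_Ioc (a := (0 : ℝ)) (b := 1 + δ)) Ioc_subset_Ioi_self
  rw [abs_one, ENNReal.ofReal_one, Real.volume_Ioc, sub_zero, one_mul] at h
  rw [← h]
  refine eLpNorm_mono_ae_real ((ae_restrict_iff' measurableSet_Ioi).2
    (Eventually.of_forall fun x hx => ?_))
  rw [Real.norm_of_nonneg ENNReal.toReal_nonneg]
  by_cases hx' : x ≤ 1 + δ
  · rw [indicator_of_mem (show x ∈ Ioc 0 (1 + δ) from ⟨hx, hx'⟩)]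
    exact ENNReal.toReal_le_of_le_ofReal zero_le_one (by
      simpa using dualHardy_bump_le_one hδ x)
  · rw [indicator_of_notMem fun h => hx' h.2, dualHardy_bump_of_ge (not_le.1 hx').le]
    simp

/-- The distance in `L^p` from `(H^*² - H^*)` of the bump to its limiting profile. -/
theorem eLpNorm_sub_logProfile_le {p : ℝ} (hp : 1 ≤ p) (hδ : 0 < δ) (hδ1 : δ ≤ 1) :
    eLpNorm (fun x => (dualHardy (dualHardy (bump δ)) x).toReal - (dualHardy (bump δ) x).toReal
        - logProfile x) (ENNReal.ofReal p) (volume.restrict (Ioi 0))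
      ≤ ENNReal.ofReal δ + ENNReal.ofReal δ ^ (1 / p) := by
  have hp0 : 0 < p := by linarith
  set s₁ : ℝ → ℝ := (Ioc (0 : ℝ) 1).indicator fun _ => δ with hs₁
  set s₂ : ℝ → ℝ := (Ioc (1 : ℝ) (1 + δ)).indicator fun _ => 1 with hs₂
  have hsub : Ioc (1 : ℝ) (1 + δ) ⊆ Ioi 0 := fun t ht => lt_trans zero_lt_one ht.1
  have e1 : eLpNorm s₁ (ENNReal.ofReal p) (volume.restrict (Ioi 0)) = ENNReal.ofReal δ := by
    rw [hs₁, eLpNorm_indicator_const_Ioi hp0 measurableSet_Ioc Ioc_subset_Ioi_self,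
      Real.volume_Ioc, abs_of_pos hδ]
    simp
  have e2 : eLpNorm s₂ (ENNReal.ofReal p) (volume.restrict (Ioi 0))
      = ENNReal.ofReal δ ^ (1 / p) := by
    rw [hs₂, eLpNorm_indicator_const_Ioi hp0 measurableSet_Ioc hsub, Real.volume_Ioc]
    simp
  rw [← e2, ← e1]
  refine le_trans (eLpNorm_mono_ae_real (g := s₁ + s₂) ((ae_restrict_iff' measurableSet_Ioi).2
    (Eventually.of_forall fun x hx => ?_))) (eLpNorm_add_le ?_ ?_ (by simpa using hp))
  · rw [mem_Ioi] at hx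
    set c := (dualHardy (dualHardy (bump δ)) 1).toReal with hc
    have hc0 : 0 ≤ c := ENNReal.toReal_nonneg
    have hcδ : c ≤ δ := ENNReal.toReal_le_of_le_ofReal hδ.le (dualHardy_sq_bump_one_le hδ)
    rw [Pi.add_apply, Real.norm_eq_abs]
    rcases le_or_gt x 1 with h | h
    · have hx1 : x ∈ Ioc (0 : ℝ) 1 := ⟨hx, h⟩
      have hx2 : x ∉ Ioc (1 : ℝ) (1 + δ) := fun h' => absurd h'.1 (by linarith)
      have hlog : 0 ≤ -Real.log x := by linarith [Real.log_nonpos hx.le h]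
      rw [hs₁, hs₂, logProfile, indicator_of_mem hx1, indicator_of_mem hx1,
        indicator_of_notMem hx2, dualHardy_sq_bump_of_le hδ hx h, dualHardy_bump_of_le hδ h,
        ENNReal.toReal_add ENNReal.ofReal_ne_top (dualHardy_sq_bump_lt_top hδ zero_lt_one).ne,
        ENNReal.toReal_ofReal hlog, ← hc, ENNReal.toReal_one]
      rw [show -Real.log x + c - 1 - (-Real.log x - 1) = c by ring, abs_of_nonneg hc0]
      linarith
    · have hx1 : x ∉ Ioc (0 : ℝ) 1 := fun h' => absurd h'.2 (by linarith)
      rw [hs₁, logProfile, indicator_of_notMem hx1, indicator_of_notMem hx1, sub_zero, zero_add]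
      by_cases h2 : x ≤ 1 + δ
      · rw [hs₂, indicator_of_mem (show x ∈ Ioc 1 (1 + δ) from ⟨h, h2⟩)]
        have a1 : (dualHardy (bump δ) x).toReal ≤ 1 :=
          ENNReal.toReal_le_of_le_ofReal zero_le_one (by simpa using dualHardy_bump_le_one hδ x)
        have a2 : (dualHardy (dualHardy (bump δ)) x).toReal ≤ c :=
          ENNReal.toReal_mono (dualHardy_sq_bump_lt_top hδ zero_lt_one).ne
            (dualHardy_antitone _ h.le)
        have a3 : 0 ≤ (dualHardy (bump δ) x).toReal := ENNReal.toReal_nonneg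
        have a4 : 0 ≤ (dualHardy (dualHardy (bump δ)) x).toReal := ENNReal.toReal_nonneg
        rw [abs_le]; constructor <;> linarith
      · rw [hs₂, indicator_of_notMem fun h' => h2 h'.2, dualHardy_bump_of_ge (not_le.1 h2).le,
          dualHardy_sq_bump_of_ge (not_le.1 h2).le]
        simp
  · exact (measurable_const.indicator measurableSet_Ioc).aestronglyMeasurable
  · exact (measurable_const.indicator measurableSet_Ioc).aestronglyMeasurable

theorem normDualHardySqSub_bump_le {p : ℝ} (hp : 1 ≤ p) (hδ : 0 < δ) (hδ1 : δ ≤ 1) :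
    normDualHardySqSub p (bump δ) ≤
      hardyConst p ^ (1 / p) + (ENNReal.ofReal δ + ENNReal.ofReal δ ^ (1 / p)) := by
  have hp0 : 0 < p := by linarith
  rw [normDualHardySqSub_eq (isAdmissible_bump hδ) fun x hx => dualHardy_sq_bump_lt_top hδ hx,
    ← eLpNorm_logProfile hp0]
  set r : ℝ → ℝ := fun x =>
    (dualHardy (dualHardy (bump δ)) x).toReal - (dualHardy (bump δ) x).toReal with hr
  have hrm : Measurable r := (measurable_dualHardy _).ennreal_toReal.sub
    (measurable_dualHardy _).ennreal_toReal
  have e : r = logProfile + fun x => r x - logProfile x := by ext x; simp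
  rw [e]
  refine (eLpNorm_add_le measurable_logProfile.aestronglyMeasurable
    (hrm.sub measurable_logProfile).aestronglyMeasurable (by simpa using hp)).trans ?_
  gcongr
  exact eLpNorm_sub_logProfile_le hp hδ hδ1

theorem hardyConst_le_normDualHardySqSub_bump {p : ℝ} (hp : 1 ≤ p) (hδ : 0 < δ) (hδ1 : δ ≤ 1) :
    hardyConst p ^ (1 / p) ≤
      normDualHardySqSub p (bump δ) + (ENNReal.ofReal δ + ENNReal.ofReal δ ^ (1 / p)) := by
  have hp0 : 0 < p := by linarith
  rw [normDualHardySqSub_eq (isAdmissible_bump hδ) fun x hx => dualHardy_sq_bump_lt_top hδ hx,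
    ← eLpNorm_logProfile hp0]
  set r : ℝ → ℝ := fun x =>
    (dualHardy (dualHardy (bump δ)) x).toReal - (dualHardy (bump δ) x).toReal with hr
  have hrm : Measurable r := (measurable_dualHardy _).ennreal_toReal.sub
    (measurable_dualHardy _).ennreal_toReal
  have e : logProfile = r - fun x => r x - logProfile x := by ext x; simp
  nth_rewrite 1 [e]
  refine (eLpNorm_sub_le hrm.aestronglyMeasurable
    (hrm.sub measurable_logProfile).aestronglyMeasurable (by simpa using hp)).trans ?_
  gcongr
  exact eLpNorm_sub_logProfile_le hp hδ hδ1

end Bump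

theorem tendsto_one_div_add_one_ennreal :
    Tendsto (fun n : ℕ => ENNReal.ofReal (1 / ((n : ℝ) + 1))) atTop (𝓝 0) := by
  simpa using ENNReal.tendsto_ofReal (tendsto_one_div_add_atTop_nhds_zero_nat (𝕜 := ℝ))

theorem tendsto_bump_error {p : ℝ} (hp : 0 < p) :
    Tendsto (fun n : ℕ => ENNReal.ofReal (1 / ((n : ℝ) + 1))
      + ENNReal.ofReal (1 / ((n : ℝ) + 1)) ^ (1 / p)) atTop (𝓝 0) := by
  have h := tendsto_one_div_add_one_ennreal
  have h2 := h.ennrpow_const (1 / p)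
  rw [ENNReal.zero_rpow_of_pos (by positivity)] at h2
  simpa using h.add h2

theorem one_div_add_one_le_one (n : ℕ) : 1 / ((n : ℝ) + 1) ≤ 1 := by
  rw [div_le_one (by positivity)]
  linarith [Nat.cast_nonneg (α := ℝ) n]

theorem normDualHardy_bump_lt_top {p δ : ℝ} (hp : 0 < p) (hδ : 0 < δ) :
    normDualHardy p (bump δ) < ∞ :=
  (normDualHardy_bump_le hp hδ).trans_lt
    (ENNReal.rpow_lt_top_of_nonneg (by positivity) ENNReal.ofReal_ne_top)

theorem le_hardyConst_of_forall {p : ℝ} (hp : 1 ≤ p) {A : ℝ≥0∞}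
    (hA : ∀ g : ℝ → ℝ≥0∞, IsAdmissible g → normDualHardy p g < ∞ →
      A * normDualHardy p g ≤ normDualHardySqSub p g) :
    A ≤ hardyConst p ^ (1 / p) := by
  have hp0 : 0 < p := by linarith
  have hlim := (tendsto_bump_error hp0).const_add (hardyConst p ^ (1 / p))
  rw [add_zero] at hlim
  refine ge_of_tendsto' hlim fun n => ?_
  have hδ : 0 < 1 / ((n : ℝ) + 1) := by positivity
  calc A = A * 1 := (mul_one A).symm
    _ ≤ A * normDualHardy p (bump (1 / ((n : ℝ) + 1))) := by
        gcongr; exact one_le_normDualHardy_bump hp0 hδ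
    _ ≤ _ := hA _ (isAdmissible_bump hδ) (normDualHardy_bump_lt_top hp0 hδ)
    _ ≤ _ := normDualHardySqSub_bump_le hp hδ (one_div_add_one_le_one n)

theorem hardyConst_le_of_forall {p : ℝ} (hp : 1 ≤ p) {B : ℝ≥0∞}
    (hB : ∀ g : ℝ → ℝ≥0∞, IsAdmissible g → normDualHardy p g < ∞ →
      normDualHardySqSub p g ≤ B * normDualHardy p g) :
    hardyConst p ^ (1 / p) ≤ B := by
  have hp0 : 0 < p := by linarith
  have h1 : Tendsto (fun n : ℕ => ENNReal.ofReal (1 + 1 / ((n : ℝ) + 1)) ^ (1 / p)) atTop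
      (𝓝 1) := by
    have := (ENNReal.tendsto_ofReal ((tendsto_one_div_add_atTop_nhds_zero_nat (𝕜 := ℝ)).const_add
      1)).ennrpow_const (1 / p)
    simpa using this
  have hlim := (ENNReal.Tendsto.const_mul (a := B) h1 (Or.inl one_ne_zero)).add
    (tendsto_bump_error hp0)
  rw [add_zero, mul_one] at hlim
  refine ge_of_tendsto' hlim fun n => ?_
  have hδ : 0 < 1 / ((n : ℝ) + 1) := by positivity
  refine (hardyConst_le_normDualHardySqSub_bump hp hδ (one_div_add_one_le_one n)).trans ?_
  gcongr
  refine (hB _ (isAdmissible_bump hδ) (normDualHardy_bump_lt_top hp0 hδ)).trans ?_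
  gcongr
  exact normDualHardy_bump_le hp0 hδ

/-! ### Optimality of the constant from power functions -/

section TruncatedPower

variable {α : ℝ}

/-- The function `α t^(-α)` on `(0,1]`, extended by zero. -/
noncomputable def truncPower (α : ℝ) : ℝ → ℝ≥0∞ :=
  (Iic (1 : ℝ)).indicator fun t => ENNReal.ofReal (α * t ^ (-α))

theorem measurable_truncPower (α : ℝ) : Measurable (truncPower α) :=
  ((measurable_id.pow_const (-α)).const_mul α).ennreal_ofReal.indicator measurableSet_Iic

theorem dualHardy_truncPower_of_ge {x : ℝ} (hx : 1 ≤ x) : dualHardy (truncPower α) x = 0 :=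
  dualHardy_eq_zero fun t ht => by
    rw [truncPower, indicator_of_notMem]
    exact fun h => absurd (mem_Iic.1 h) (by linarith)

theorem dualHardy_truncPower_of_le (hα : 0 < α) {x : ℝ} (hx0 : 0 < x) (hx : x ≤ 1) :
    dualHardy (truncPower α) x = ENNReal.ofReal (x ^ (-α) - 1) := by
  rw [dualHardy_eq_add hx, dualHardy_truncPower_of_ge le_rfl, add_zero]
  have hpos : ∀ t ∈ Icc x 1, 0 < t := fun t ht => hx0.trans_le ht.1
  have h := setLIntegral_Ioc_div_eq (w := fun t => α * t ^ (-α)) (W := fun t => t ^ (-α)) hx0 hx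
    (continuousOn_const.mul (continuousOn_id.rpow_const fun t ht => Or.inl (hpos t ht).ne'))
    (fun t ht => mul_nonneg hα.le (Real.rpow_nonneg (hpos t ht).le _)) fun t ht => by
      have := (hasDerivAt_id t).rpow_const (p := -α) (Or.inl (hpos t ht).ne')
      refine this.congr_deriv ?_
      simp only [id]
      rw [Real.rpow_sub_one (hpos t ht).ne']
      ring
  rw [Real.one_rpow] at h
  rw [← h]
  refine setLIntegral_congr_fun measurableSet_Ioc fun t ht => ?_
  simp only [truncPower, indicator_of_mem (mem_Iic.2 ht.2)]

theorem isAdmissible_truncPower (hα : 0 < α) : IsAdmissible (truncPower α) := by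
  refine ⟨(measurable_truncPower α).aemeasurable, fun x hx => ?_⟩
  rcases le_total x 1 with h | h
  · rw [dualHardy_truncPower_of_le hα hx h]; exact ENNReal.ofReal_lt_top
  · rw [dualHardy_truncPower_of_ge h]; exact ENNReal.zero_lt_top

theorem dualHardy_sq_truncPower_of_ge {x : ℝ} (hx : 1 ≤ x) :
    dualHardy (dualHardy (truncPower α)) x = 0 :=
  dualHardy_eq_zero fun _ ht => dualHardy_truncPower_of_ge (hx.trans ht.le)

theorem one_le_rpow_neg (hα : 0 < α) {t : ℝ} (ht0 : 0 < t) (ht : t ≤ 1) : 1 ≤ t ^ (-α) :=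
  Real.one_le_rpow_of_pos_of_le_one_of_nonpos ht0 ht (by linarith)

theorem dualHardy_sq_truncPower_of_le (hα : 0 < α) {x : ℝ} (hx0 : 0 < x) (hx : x ≤ 1) :
    dualHardy (dualHardy (truncPower α)) x
      = ENNReal.ofReal (1 / α * (x ^ (-α) - 1) + Real.log x) := by
  rw [dualHardy_eq_add hx, dualHardy_sq_truncPower_of_ge le_rfl, add_zero]
  have hpos : ∀ t ∈ Icc x 1, 0 < t := fun t ht => hx0.trans_le ht.1
  have h := setLIntegral_Ioc_div_eq (w := fun t => t ^ (-α) - 1)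
    (W := fun t => 1 / α * t ^ (-α) + Real.log t) hx0 hx
    ((continuousOn_id.rpow_const fun t ht => Or.inl (hpos t ht).ne').sub continuousOn_const)
    (fun t ht => sub_nonneg.2 (one_le_rpow_neg hα (hpos t ht) ht.2)) fun t ht => by
      have := (((hasDerivAt_id t).rpow_const (p := -α) (Or.inl (hpos t ht).ne')).const_mul
        (1 / α)).add (Real.hasDerivAt_log (hpos t ht).ne')
      refine this.congr_deriv ?_
      simp only [id]
      have := hpos t ht
      rw [Real.rpow_sub_one this.ne']
      field_simp
      ring
  rw [Real.one_rpow, Real.log_one] at h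
  rw [show 1 / α * (x ^ (-α) - 1) + Real.log x = 1 / α * x ^ (-α) + Real.log x - (1 / α * 1 + 0)
    by ring, ← h]
  refine setLIntegral_congr_fun measurableSet_Ioc fun t ht => ?_
  simp only [dualHardy_truncPower_of_le hα (hx0.trans ht.1) ht.2]

theorem dualHardy_sq_truncPower_lt_top (hα : 0 < α) {x : ℝ} (hx : 0 < x) :
    dualHardy (dualHardy (truncPower α)) x < ∞ := by
  rcases le_total x 1 with h | h
  · rw [dualHardy_sq_truncPower_of_le hα hx h]; exact ENNReal.ofReal_lt_top
  · rw [dualHardy_sq_truncPower_of_ge h]; exact ENNReal.zero_lt_top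

theorem toReal_dualHardy_truncPower (hα : 0 < α) {x : ℝ} (hx0 : 0 < x) :
    (dualHardy (truncPower α) x).toReal
      = (Ioc (0 : ℝ) 1).indicator (fun x => x ^ (-α)) x
        - (Ioc (0 : ℝ) 1).indicator (fun _ => 1) x := by
  rcases le_or_gt x 1 with h | h
  · have hm : x ∈ Ioc (0 : ℝ) 1 := ⟨hx0, h⟩
    rw [indicator_of_mem hm, indicator_of_mem hm, dualHardy_truncPower_of_le hα hx0 h,
      ENNReal.toReal_ofReal (sub_nonneg.2 (one_le_rpow_neg hα hx0 h))]
  · have hm : x ∉ Ioc (0 : ℝ) 1 := fun h' => absurd h'.2 (by linarith)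
    rw [indicator_of_notMem hm, indicator_of_notMem hm, dualHardy_truncPower_of_ge h.le]
    simp

theorem toReal_dualHardy_sq_truncPower (hα : 0 < α) {x : ℝ} (hx0 : 0 < x) :
    (dualHardy (dualHardy (truncPower α)) x).toReal
      = 1 / α * (dualHardy (truncPower α) x).toReal
        - (logProfile x + (Ioc (0 : ℝ) 1).indicator (fun _ => 1) x) := by
  rcases le_or_gt x 1 with h | h
  · have hm : x ∈ Ioc (0 : ℝ) 1 := ⟨hx0, h⟩
    have h1 := one_le_rpow_neg hα hx0 h
    -- `log x ≥ -(x^(-α) - 1)/α`, so the value is not truncated by `ofReal`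
    have h2 : 0 ≤ 1 / α * (x ^ (-α) - 1) + Real.log x := by
      have h3 := Real.log_le_sub_one_of_pos (Real.rpow_pos_of_pos hx0 (-α))
      rw [Real.log_rpow hx0] at h3
      have h4 := mul_le_mul_of_nonneg_left h3 (by positivity : 0 ≤ 1 / α)
      have h5 : 1 / α * (-α * Real.log x) = -Real.log x := by field_simp
      linarith
    rw [logProfile, indicator_of_mem hm, indicator_of_mem hm,
      dualHardy_sq_truncPower_of_le hα hx0 h, dualHardy_truncPower_of_le hα hx0 h,
      ENNReal.toReal_ofReal h2, ENNReal.toReal_ofReal (sub_nonneg.2 h1)]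
    ring
  · have hm : x ∉ Ioc (0 : ℝ) 1 := fun h' => absurd h'.2 (by linarith)
    rw [logProfile, indicator_of_notMem hm, indicator_of_notMem hm,
      dualHardy_sq_truncPower_of_ge h.le, dualHardy_truncPower_of_ge h.le]
    simp

theorem eLpNorm_indicator_rpow {p : ℝ} (hp : 0 < p) (hαp : α * p < 1) :
    eLpNorm ((Ioc (0 : ℝ) 1).indicator fun x => x ^ (-α)) (ENNReal.ofReal p)
      (volume.restrict (Ioi 0)) = ENNReal.ofReal (1 / (1 - α * p)) ^ (1 / p) := by
  rw [eLpNorm_Ioi_eq hp]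
  congr 1
  have h1 : ∀ x, ENNReal.ofReal (|(Ioc (0 : ℝ) 1).indicator (fun x => x ^ (-α)) x| ^ p)
      = (Ioc (0 : ℝ) 1).indicator (fun x => ENNReal.ofReal (x ^ (-(α * p)))) x := fun x => by
    by_cases hx : x ∈ Ioc (0 : ℝ) 1
    · rw [indicator_of_mem hx, indicator_of_mem hx, abs_of_nonneg (Real.rpow_nonneg hx.1.le _),
        ← Real.rpow_mul hx.1.le, neg_mul]
    · rw [indicator_of_notMem hx, indicator_of_notMem hx, abs_zero, Real.zero_rpow hp.ne',
        ENNReal.ofReal_zero]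
  simp_rw [h1]
  have hlt : -1 < -(α * p) := by linarith
  rw [lintegral_indicator measurableSet_Ioc, Measure.restrict_restrict measurableSet_Ioc,
    inter_eq_self_of_subset_left Ioc_subset_Ioi_self, ← ofReal_integral_eq_lintegral_ofReal
    ((intervalIntegrable_iff_integrableOn_Ioc_of_le zero_le_one).1
      (intervalIntegral.intervalIntegrable_rpow' hlt))
    ((ae_restrict_iff' measurableSet_Ioc).2 (Eventually.of_forall fun t ht =>
      Real.rpow_nonneg ht.1.le _)),
    ← intervalIntegral.integral_of_le zero_le_one, integral_rpow (Or.inl hlt), Real.one_rpow,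
    Real.zero_rpow (by linarith), sub_zero, neg_add_eq_sub]

theorem eLpNorm_indicator_one {p : ℝ} (hp : 0 < p) :
    eLpNorm ((Ioc (0 : ℝ) 1).indicator fun _ => (1 : ℝ)) (ENNReal.ofReal p)
      (volume.restrict (Ioi 0)) = 1 := by
  rw [eLpNorm_indicator_const_Ioi hp measurableSet_Ioc Ioc_subset_Ioi_self]
  simp

theorem eLpNorm_logProfile_add_le {p : ℝ} (hp : 1 ≤ p) :
    eLpNorm (logProfile + (Ioc (0 : ℝ) 1).indicator fun _ => (1 : ℝ)) (ENNReal.ofReal p)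
      (volume.restrict (Ioi 0)) ≤ hardyConst p ^ (1 / p) + 1 := by
  have hp0 : 0 < p := by linarith
  rw [← eLpNorm_logProfile hp0, ← eLpNorm_indicator_one hp0]
  exact eLpNorm_add_le measurable_logProfile.aestronglyMeasurable
    (measurable_const.indicator measurableSet_Ioc).aestronglyMeasurable (by simpa using hp)

theorem normDualHardy_truncPower_lt_top {p : ℝ} (hp : 1 ≤ p) (hα : 0 < α) (hαp : α * p < 1) :
    normDualHardy p (truncPower α) < ∞ := by
  have hp0 : 0 < p := by linarith
  rw [normDualHardy_eq (isAdmissible_truncPower hα)]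
  have hm : Measurable ((Ioc (0 : ℝ) 1).indicator fun x : ℝ => x ^ (-α)) :=
    (measurable_id.pow_const (-α)).indicator measurableSet_Ioc
  have hm1 : Measurable ((Ioc (0 : ℝ) 1).indicator fun _ : ℝ => (1 : ℝ)) :=
    measurable_const.indicator measurableSet_Ioc
  rw [eLpNorm_congr_ae (g := ((Ioc (0 : ℝ) 1).indicator fun x : ℝ => x ^ (-α))
    - (Ioc (0 : ℝ) 1).indicator fun _ : ℝ => (1 : ℝ)) ((ae_restrict_iff' measurableSet_Ioi).2
      (Eventually.of_forall fun x hx => toReal_dualHardy_truncPower hα hx))]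
  refine (eLpNorm_sub_le hm.aestronglyMeasurable hm1.aestronglyMeasurable
    (by simpa using hp)).trans_lt ?_
  rw [eLpNorm_indicator_rpow hp0 hαp, eLpNorm_indicator_one hp0]
  exact ENNReal.add_lt_top.2 ⟨ENNReal.rpow_lt_top_of_nonneg (by positivity)
    ENNReal.ofReal_ne_top, ENNReal.one_lt_top⟩

theorem le_normDualHardy_truncPower_add_one {p : ℝ} (hp : 1 ≤ p) (hα : 0 < α)
    (hαp : α * p < 1) :
    ENNReal.ofReal (1 / (1 - α * p)) ^ (1 / p) ≤ normDualHardy p (truncPower α) + 1 := by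
  have hp0 : 0 < p := by linarith
  rw [normDualHardy_eq (isAdmissible_truncPower hα), ← eLpNorm_indicator_rpow hp0 hαp,
    ← eLpNorm_indicator_one hp0]
  rw [eLpNorm_congr_ae (f := (Ioc (0 : ℝ) 1).indicator fun x : ℝ => x ^ (-α))
    (g := (fun x => (dualHardy (truncPower α) x).toReal)
      + (Ioc (0 : ℝ) 1).indicator fun _ : ℝ => (1 : ℝ)) ((ae_restrict_iff' measurableSet_Ioi).2
      (Eventually.of_forall fun x hx => by
        rw [Pi.add_apply, toReal_dualHardy_truncPower hα hx, sub_add_cancel]))]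
  exact eLpNorm_add_le (measurable_dualHardy _).ennreal_toReal.aestronglyMeasurable
    (measurable_const.indicator measurableSet_Ioc).aestronglyMeasurable (by simpa using hp)

theorem normDualHardySqSub_truncPower_bounds {p : ℝ} (hp : 1 ≤ p) (hα : 0 < α) (hα1 : α ≤ 1) :
    normDualHardySqSub p (truncPower α)
        ≤ ENNReal.ofReal (1 / α - 1) * normDualHardy p (truncPower α)
          + (hardyConst p ^ (1 / p) + 1) ∧
      ENNReal.ofReal (1 / α - 1) * normDualHardy p (truncPower α)
        ≤ normDualHardySqSub p (truncPower α) + (hardyConst p ^ (1 / p) + 1) := by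
  have hp0 : 0 < p := by linarith
  have hκ : 0 ≤ 1 / α - 1 := sub_nonneg.2 ((one_le_div hα).2 hα1)
  set f : ℝ → ℝ := fun x => (dualHardy (truncPower α) x).toReal with hf
  set L : ℝ → ℝ := logProfile + (Ioc (0 : ℝ) 1).indicator fun _ => (1 : ℝ) with hL
  set r : ℝ → ℝ := fun x => (dualHardy (dualHardy (truncPower α)) x).toReal - f x with hr
  have hfm : Measurable f := (measurable_dualHardy _).ennreal_toReal
  have hrm : Measurable r := (measurable_dualHardy _).ennreal_toReal.sub hfm
  have hLm : Measurable L :=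
    measurable_logProfile.add (measurable_const.indicator measurableSet_Ioc)
  have hrel : ∀ x, 0 < x → r x = (1 / α - 1) * f x - L x := fun x hx => by
    rw [hr, hL]
    simp only [toReal_dualHardy_sq_truncPower hα hx, Pi.add_apply]
    ring
  have hsmul : ENNReal.ofReal (1 / α - 1) * eLpNorm f (ENNReal.ofReal p)
      (volume.restrict (Ioi 0)) = eLpNorm ((1 / α - 1) • f) (ENNReal.ofReal p)
      (volume.restrict (Ioi 0)) := by
    rw [eLpNorm_const_smul, Real.enorm_eq_ofReal hκ]
  have hcm : Measurable ((1 / α - 1) • f) := hfm.const_smul _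
  have hp' : 1 ≤ ENNReal.ofReal p := by simpa using hp
  rw [normDualHardySqSub_eq (isAdmissible_truncPower hα)
      (fun x hx => dualHardy_sq_truncPower_lt_top hα hx),
    normDualHardy_eq (isAdmissible_truncPower hα), hsmul]
  have hle := eLpNorm_logProfile_add_le hp
  constructor
  · rw [eLpNorm_congr_ae (f := r) (g := (1 / α - 1) • f - L)
      ((ae_restrict_iff' measurableSet_Ioi).2 (Eventually.of_forall fun x hx => hrel x hx))]
    refine (eLpNorm_sub_le hcm.aestronglyMeasurable hLm.aestronglyMeasurable hp').trans ?_
    gcongr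
  · rw [eLpNorm_congr_ae (f := (1 / α - 1) • f) (g := r + L)
      ((ae_restrict_iff' measurableSet_Ioi).2 (Eventually.of_forall fun x hx => by
        rw [Pi.add_apply, hrel x hx, sub_add_cancel]; rfl))]
    refine (eLpNorm_add_le hrm.aestronglyMeasurable hLm.aestronglyMeasurable hp').trans ?_
    gcongr

end TruncatedPower

/-- Exponents increasing to the critical value `1 / p`. -/
noncomputable def subcriticalExponent (p : ℝ) (n : ℕ) : ℝ := (n + 1) / ((n + 2) * p)

section Subcritical

variable {p : ℝ}

theorem subcriticalExponent_pos (hp : 0 < p) (n : ℕ) : 0 < subcriticalExponent p n := by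
  unfold subcriticalExponent; positivity

theorem one_sub_subcriticalExponent_mul (hp : 0 < p) (n : ℕ) :
    1 - subcriticalExponent p n * p = 1 / ((n : ℝ) + 2) := by
  unfold subcriticalExponent; field_simp; ring

theorem subcriticalExponent_mul_lt_one (hp : 0 < p) (n : ℕ) : subcriticalExponent p n * p < 1 := by
  have h := one_sub_subcriticalExponent_mul hp n
  have : 0 < 1 / ((n : ℝ) + 2) := by positivity
  linarith

theorem subcriticalExponent_le_one (hp : 1 ≤ p) (n : ℕ) : subcriticalExponent p n ≤ 1 := by
  have h0 := subcriticalExponent_pos (by linarith : 0 < p) n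
  have h := subcriticalExponent_mul_lt_one (by linarith : 0 < p) n
  nlinarith

theorem tendsto_one_div_subcriticalExponent (hp : 0 < p) :
    Tendsto (fun n : ℕ => ENNReal.ofReal (1 / subcriticalExponent p n - 1)) atTop
      (𝓝 (ENNReal.ofReal (p - 1))) := by
  have h : ∀ n : ℕ, 1 / subcriticalExponent p n - 1 = p * (1 + 1 / ((n : ℝ) + 1)) - 1 :=
    fun n => by
      have hp0 := hp.ne'
      unfold subcriticalExponent; field_simp; ring
  simp_rw [h]
  refine ENNReal.tendsto_ofReal ?_
  simpa using (((tendsto_one_div_add_atTop_nhds_zero_nat (𝕜 := ℝ)).const_add 1).const_mul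
    p).sub_const 1

theorem tendsto_normDualHardy_truncPower (hp : 1 ≤ p) :
    Tendsto (fun n : ℕ => normDualHardy p (truncPower (subcriticalExponent p n))) atTop (𝓝 ∞) := by
  have hp0 : 0 < p := by linarith
  have h1 : Tendsto (fun n : ℕ => ENNReal.ofReal ((n : ℝ) + 2) ^ (1 / p)) atTop (𝓝 ∞) := by
    have := (ENNReal.tendsto_ofReal_atTop.comp (tendsto_atTop_add_const_right _ (2 : ℝ)
      (tendsto_natCast_atTop_atTop (R := ℝ)))).ennrpow_const (1 / p)
    rwa [ENNReal.top_rpow_of_pos (by positivity)] at this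
  have h2 : Tendsto (fun n : ℕ => normDualHardy p (truncPower (subcriticalExponent p n)) + 1)
      atTop (𝓝 ∞) := by
    refine tendsto_nhds_top_mono' h1 fun n => ?_
    have := le_normDualHardy_truncPower_add_one hp (subcriticalExponent_pos hp0 n)
      (subcriticalExponent_mul_lt_one hp0 n)
    rwa [one_sub_subcriticalExponent_mul hp0, one_div_one_div] at this
  have h3 := ENNReal.Tendsto.sub h2 (tendsto_const_nhds (x := (1 : ℝ≥0∞)))
    (Or.inr ENNReal.one_ne_top)
  rw [ENNReal.top_sub ENNReal.one_ne_top] at h3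
  exact h3.congr fun n => ENNReal.add_sub_cancel_right ENNReal.one_ne_top

theorem tendsto_div_normDualHardy_truncPower (hp : 1 ≤ p) :
    Tendsto (fun n : ℕ => (hardyConst p ^ (1 / p) + 1)
      / normDualHardy p (truncPower (subcriticalExponent p n))) atTop (𝓝 0) := by
  have hL : hardyConst p ^ (1 / p) + 1 ≠ ∞ :=
    ENNReal.add_ne_top.2 ⟨hardyConst_rpow_ne_top (by linarith), ENNReal.one_ne_top⟩
  have := ENNReal.Tendsto.const_div (tendsto_normDualHardy_truncPower hp) (Or.inr hL)
  rwa [ENNReal.div_top] at this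

theorem eventually_normDualHardy_truncPower_ne_zero (hp : 1 ≤ p) :
    ∀ᶠ n : ℕ in atTop, normDualHardy p (truncPower (subcriticalExponent p n)) ≠ 0 :=
  ((tendsto_normDualHardy_truncPower hp).eventually (lt_mem_nhds ENNReal.zero_lt_top)).mono
    fun _ hn => hn.ne'

theorem le_add_div_of_mul_le {a b c N : ℝ≥0∞} (h0 : N ≠ 0) (ht : N ≠ ∞)
    (h : a * N ≤ b * N + c) : a ≤ b + c / N := by
  have := ENNReal.div_le_div_right h N
  rwa [ENNReal.add_div, ENNReal.mul_div_cancel_right h0 ht, ENNReal.mul_div_cancel_right h0 ht]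
    at this

theorem le_sub_one_of_forall (hp : 1 ≤ p) {A : ℝ≥0∞}
    (hA : ∀ g : ℝ → ℝ≥0∞, IsAdmissible g → normDualHardy p g < ∞ →
      A * normDualHardy p g ≤ normDualHardySqSub p g) :
    A ≤ ENNReal.ofReal (p - 1) := by
  have hp0 : 0 < p := by linarith
  have hlim := (tendsto_one_div_subcriticalExponent hp0).add
    (tendsto_div_normDualHardy_truncPower hp)
  rw [add_zero] at hlim
  refine ge_of_tendsto hlim ((eventually_normDualHardy_truncPower_ne_zero hp).mono fun n hn => ?_)
  have hα := subcriticalExponent_pos hp0 n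
  have hfin := normDualHardy_truncPower_lt_top hp hα (subcriticalExponent_mul_lt_one hp0 n)
  exact le_add_div_of_mul_le hn hfin.ne ((hA _ (isAdmissible_truncPower hα) hfin).trans
    (normDualHardySqSub_truncPower_bounds hp hα (subcriticalExponent_le_one hp n)).1)

theorem sub_one_le_of_forall (hp : 1 ≤ p) {B : ℝ≥0∞}
    (hB : ∀ g : ℝ → ℝ≥0∞, IsAdmissible g → normDualHardy p g < ∞ →
      normDualHardySqSub p g ≤ B * normDualHardy p g) :
    ENNReal.ofReal (p - 1) ≤ B := by
  have hp0 : 0 < p := by linarith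
  have hlim := (tendsto_div_normDualHardy_truncPower hp).const_add B
  rw [add_zero] at hlim
  refine le_of_tendsto_of_tendsto (tendsto_one_div_subcriticalExponent hp0) hlim
    ((eventually_normDualHardy_truncPower_ne_zero hp).mono fun n hn => ?_)
  have hα := subcriticalExponent_pos hp0 n
  have hfin := normDualHardy_truncPower_lt_top hp hα (subcriticalExponent_mul_lt_one hp0 n)
  refine le_add_div_of_mul_le hn hfin.ne ((normDualHardySqSub_truncPower_bounds hp hα
    (subcriticalExponent_le_one hp n)).2.trans ?_)
  gcongr
  exact hB _ (isAdmissible_truncPower hα) hfin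

end Subcritical

theorem corollary2p5 (p : ℝ) (hp : 1 < p) :
    (p ≤ 2 →
      (∀ g : ℝ → ℝ≥0∞, IsAdmissible g →
        (normDualHardy p g < ∞ →
          ENNReal.ofReal (p - 1) * normDualHardy p g ≤ normDualHardySqSub p g) ∧
        normDualHardySqSub p g ≤ hardyConst p ^ (1 / p) * normDualHardy p g) ∧
      (∀ A : ℝ≥0∞,
        (∀ g : ℝ → ℝ≥0∞, IsAdmissible g → normDualHardy p g < ∞ →
          A * normDualHardy p g ≤ normDualHardySqSub p g) →
        A ≤ ENNReal.ofReal (p - 1)) ∧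
      (∀ B : ℝ≥0∞,
        (∀ g : ℝ → ℝ≥0∞, IsAdmissible g → normDualHardy p g < ∞ →
          normDualHardySqSub p g ≤ B * normDualHardy p g) →
        hardyConst p ^ (1 / p) ≤ B)) ∧
    (2 ≤ p →
      (∀ g : ℝ → ℝ≥0∞, IsAdmissible g →
        (normDualHardy p g < ∞ →
          hardyConst p ^ (1 / p) * normDualHardy p g ≤ normDualHardySqSub p g) ∧
        normDualHardySqSub p g ≤ ENNReal.ofReal (p - 1) * normDualHardy p g) ∧
      (∀ A : ℝ≥0∞,
        (∀ g : ℝ → ℝ≥0∞, IsAdmissible g → normDualHardy p g < ∞ →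
          A * normDualHardy p g ≤ normDualHardySqSub p g) →
        A ≤ hardyConst p ^ (1 / p)) ∧
      (∀ B : ℝ≥0∞,
        (∀ g : ℝ → ℝ≥0∞, IsAdmissible g → normDualHardy p g < ∞ →
          normDualHardySqSub p g ≤ B * normDualHardy p g) →
        ENNReal.ofReal (p - 1) ≤ B)) := by
  refine ⟨fun hp2 => ⟨fun g hg => ⟨?_, ?_⟩, ?_, ?_⟩, fun hp2 => ⟨fun g hg => ⟨?_, ?_⟩, ?_, ?_⟩⟩
  · exact sub_one_mul_normDualHardy_le hp hp2 hg
  · exact normDualHardySqSub_le_hardyConst hp hp2 hg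
  · exact fun A hA => le_sub_one_of_forall hp.le hA
  · exact fun B hB => hardyConst_le_of_forall hp.le hB
  · exact hardyConst_mul_normDualHardy_le hp2 hg
  · exact normDualHardySqSub_le_sub_one hp2 hg
  · exact fun A hA => le_hardyConst_of_forall hp.le hA
  · exact fun B hB => sub_one_le_of_forall hp.le hB
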